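/- Let $\mathbb{T}$ be the unit circle with normalized Lebesgue measure and let $H^2(\mathbb{T})$ be the closed subspace of $L^2(\mathbb{T})$ with orthonormal basis $z\mapsto z^n$, $n=0,1,2,\dots$, with orthogonal projection $P:L^2(\mathbb{T})\to H^2(\mathbb{T})$. Let $R\neq 0$ and $S\neq 0$ be complex polynomials without common zeros, let $\omega=R/S$ on $\mathbb{T}$, and let $T_\omega$ be the (possibly unbounded) Toeplitz operator in $H^2(\mathbb{T})$ given by $T_\omega u=P(\omega u)$ on the domain $\{u\in H^2(\mathbb{T}):\omega u\in L^2(\mathbb{T})\}$. Write $\omega(\mathbb{T})=\{R(z)/S(z): |z|=1,\ S(z)\neq 0\}$. For a polynomial $p\neq 0$ let $p_{in}$ and $p_{\overline{in}}$ be the monic polynomials whose zeros are, with the same multiplicities, the zeros of $p$ of modulus $<1$ and of modulus $\le 1$, respectively; for $p=0$ put $p_{in}=p_{\overline{in}}=0$, with $\deg 0=-\infty$. A densely defined closed operator $A$ in $H^2(\mathbb{T})$ is called a Fredholm operator if its kernel and its cokernel $H^2(\mathbb{T})/\operatorname{ran}A$ are finite dimensional and its range is closed; then $\operatorname{ind}A=\dim\ker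 A-\dim\big(H^2(\mathbb{T})/\operatorname{ran}A\big)$. Let $\lambda\in\mathbb{C}$ and put $R^\lambda:=R-\lambda S$. Then, referring to $T_\omega$: 1. $\lambda$ is a Fredholm point (i.e. $T_\omega-\lambda I$ is a Fredholm operator) iff $\lambda\notin\omega(\mathbb{T})$. If $\lambda$ is a Fredholm point, then $\dim\ker(T_\omega-\lambda I)=\max\{0,\deg S_{in}-\deg R^\lambda_{in}\}$, $\dim\operatorname{ran}(T_\omega-\lambda I)^\perp=\max\{0,\deg R^\lambda_{in}-\deg S_{in}\}$, and $\operatorname{ind}(T_\omega-\lambda I)=\deg S_{in}-\deg R^\lambda_{in}$. 2. $\lambda$ is a regular value (i.e. $T_\omega-\lambda I$ is injective and its inverse, defined on $\operatorname{ran}(T_\omega-\lambda I)$, is continuous) iff $\lambda\notin\omega(\mathbb{T})$ and $\deg S_{in}\le\deg R^\lambda_{in}$. 3. $\lambda$ is in the resolvent set (i.e. $\lambda$ is a regular value and $T_\omega-\lambda I$ is surjective) iff $\lambda\notin\omega(\mathbb{T})$ and $\deg S_{in}=\deg R^\lambda_{in}$. 4. $\lambda$ is a spectral value (i.e. not in the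 resolvent set) iff $\lambda\in\omega(\mathbb{T})$ or $\deg S_{in}\neq\deg R^\lambda_{in}$. 5. $\lambda$ is in the point spectrum (i.e. an eigenvalue of $T_\omega$) iff $\deg R^\lambda_{\overline{in}}<\deg S_{in}$. 6. $\lambda$ is in the continuous spectrum (i.e. $T_\omega-\lambda I$ is injective with dense, not closed range) iff $\lambda\in\omega(\mathbb{T})$ and $\deg R^\lambda_{in}\le\deg S_{in}\le\deg R^\lambda_{\overline{in}}$. 7. $\lambda$ is in the residual spectrum (i.e. $T_\omega-\lambda I$ is injective and its range is not dense) iff $\deg S_{in}<\deg R^\lambda_{in}$. -/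

import Mathlib

open MeasureTheory Polynomial
open scoped ENNReal

noncomputable section

namespace RationalToeplitz

/-! ### The Hardy space

The torus is `UnitAddCircle`, whose point `x` stands for `AddCircle.toCircle x` on the unit circle
of `ℂ`, with normalized Haar measure; `fourierLp 2 n` is the class of `z ↦ z ^ n`. -/

/-- `L²` of the torus with normalized Lebesgue measure. -/
abbrev L2T : Type := Lp ℂ 2 (AddCircle.haarAddCircle : Measure UnitAddCircle)

/-- The Hardy space `H²`: the closed subspace of `L²` with orthonormal basis
`z ↦ z ^ n`, `n = 0, 1, 2, …`. -/
def hardySpace : Submodule ℂ L2T :=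
  (Submodule.span ℂ
    (Set.range fun n : ℕ => (fourierLp 2 (n : ℤ) : L2T))).topologicalClosure

instance : CompleteSpace hardySpace :=
  (Submodule.isClosed_topologicalClosure _).completeSpace_coe

/-! ### Toeplitz operators -/

/-- `{u ∈ H² | ω u ∈ L²}`. -/
def toeplitzDomain (ω : UnitAddCircle → ℂ) : Submodule ℂ hardySpace where
  carrier := {u | MemLp (fun x => ω x * (u : L2T) x) 2 AddCircle.haarAddCircle}
  zero_mem' := by
    refine (MemLp.zero (p := 2) (ε := ℂ) (μ := AddCircle.haarAddCircle)).ae_eq ?_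
    filter_upwards [Lp.coeFn_zero ℂ 2 (AddCircle.haarAddCircle : Measure UnitAddCircle)] with x hx
    rw [show (((0 : hardySpace) : L2T) : UnitAddCircle → ℂ) x = 0 from hx, mul_zero]
    rfl
  add_mem' := by
    intro u v hu hv
    refine (MemLp.add hu hv).ae_eq ?_
    filter_upwards [Lp.coeFn_add (u : L2T) (v : L2T)] with x hx
    rw [show ((u + v : hardySpace) : L2T) x = (u : L2T) x + (v : L2T) x from hx, mul_add]
    rfl
  smul_mem' := by
    intro c u hu
    refine (MemLp.const_smul hu c).ae_eq ?_
    filter_upwards [Lp.coeFn_smul c (u : L2T)] with x hx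
    rw [show ((c • u : hardySpace) : L2T) x = c * (u : L2T) x from hx, mul_left_comm]
    rfl

theorem mem_toeplitzDomain {ω : UnitAddCircle → ℂ} {u : hardySpace} :
    u ∈ toeplitzDomain ω ↔
      MemLp (fun x => ω x * (u : L2T) x) 2 AddCircle.haarAddCircle := Iff.rfl

/-- Multiplication by `ω`, from `{u ∈ H² | ω u ∈ L²}` to `L²`. -/
def mulSymbol (ω : UnitAddCircle → ℂ) : toeplitzDomain ω →ₗ[ℂ] L2T where
  toFun u := MemLp.toLp (fun x => ω x * ((u : hardySpace) : L2T) x) (mem_toeplitzDomain.1 u.2)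
  map_add' := by
    intro u v
    refine Eq.trans ?_ (MemLp.toLp_add (mem_toeplitzDomain.1 u.2) (mem_toeplitzDomain.1 v.2))
    refine (MemLp.toLp_eq_toLp_iff _ _).2 ?_
    filter_upwards [Lp.coeFn_add ((u : hardySpace) : L2T) ((v : hardySpace) : L2T)] with x hx
    rw [show (((u + v : toeplitzDomain ω) : hardySpace) : L2T) x =
      ((u : hardySpace) : L2T) x + ((v : hardySpace) : L2T) x from hx, mul_add]
    rfl
  map_smul' := by
    intro c u
    refine Eq.trans ?_ (MemLp.toLp_const_smul c (mem_toeplitzDomain.1 u.2))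
    refine (MemLp.toLp_eq_toLp_iff _ _).2 ?_
    filter_upwards [Lp.coeFn_smul c ((u : hardySpace) : L2T)] with x hx
    rw [show (((c • u : toeplitzDomain ω) : hardySpace) : L2T) x =
      c * ((u : hardySpace) : L2T) x from hx, mul_left_comm]
    rfl

/-- The (possibly unbounded) Toeplitz operator `u ↦ P (ω u)` in `H²`, on its maximal domain
`{u ∈ H² | ω u ∈ L²}`. -/
def toeplitz (ω : UnitAddCircle → ℂ) : hardySpace →ₗ.[ℂ] hardySpace where
  domain := toeplitzDomain ω
  toFun := hardySpace.orthogonalProjectionOnto.toLinearMap ∘ₗ mulSymbol ω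

/-! ### Unbounded operators in a Hilbert space -/

section Operators

variable {H : Type*} [NormedAddCommGroup H] [InnerProductSpace ℂ H]

/-- The operator `T - z I` on the domain of `T`. -/
def subScalar (T : H →ₗ.[ℂ] H) (z : ℂ) : H →ₗ.[ℂ] H where
  domain := T.domain
  toFun := T.toFun - z • T.domain.subtype

/-- The kernel of `T`, as a subspace of the domain. -/
abbrev kernel (T : H →ₗ.[ℂ] H) : Submodule ℂ T.domain := LinearMap.ker T.toFun

/-- The range of `T`. -/
abbrev range (T : H →ₗ.[ℂ] H) : Submodule ℂ H := LinearMap.range T.toFun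

/-- Densely defined closed operators with finite-dimensional kernel and cokernel
and with closed range. -/
structure IsFredholm (T : H →ₗ.[ℂ] H) : Prop where
  dense_domain : Dense (T.domain : Set H)
  closed : T.IsClosed
  finite_ker : FiniteDimensional ℂ (kernel T)
  finite_coker : FiniteDimensional ℂ (H ⧸ range T)
  closed_range : IsClosed (range T : Set H)

/-- `dim ker T - dim coker T`, meaningful for Fredholm operators. -/
def index (T : H →ₗ.[ℂ] H) : ℤ :=
  (Module.finrank ℂ (kernel T) : ℤ) - (Module.finrank ℂ (H ⧸ range T) : ℤ)

/-- `T` is injective and its inverse, defined on the range of `T`, is continuous. -/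
def IsContinuouslyInvertible (T : H →ₗ.[ℂ] H) : Prop :=
  kernel T = ⊥ ∧ Continuous fun y : T.inverse.domain => T.inverse y

/-- The Fredholm points of `T`. -/
def fredholmPoints (T : H →ₗ.[ℂ] H) : Set ℂ := {z | IsFredholm (subScalar T z)}

/-- The regular values of `T`; `T - z I` need not be surjective. -/
def regularValues (T : H →ₗ.[ℂ] H) : Set ℂ := {z | IsContinuouslyInvertible (subScalar T z)}

/-- `T - z I` is a bijection from the domain onto the whole space with continuous inverse. -/
def resolventPoints (T : H →ₗ.[ℂ] H) : Set ℂ :=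
  {z | IsContinuouslyInvertible (subScalar T z) ∧ range (subScalar T z) = ⊤}

/-- The spectrum of `T`. -/
def spectralValues (T : H →ₗ.[ℂ] H) : Set ℂ := (resolventPoints T)ᶜ

/-- The eigenvalues of `T`. -/
def pointSpectrum (T : H →ₗ.[ℂ] H) : Set ℂ :=
  {z | ∃ u : T.domain, u ≠ 0 ∧ T u = z • (u : H)}

/-- `T - z I` is injective with dense, not closed range. -/
def continuousSpectrum (T : H →ₗ.[ℂ] H) : Set ℂ :=
  {z | kernel (subScalar T z) = ⊥ ∧ Dense (range (subScalar T z) : Set H) ∧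
    ¬ IsClosed (range (subScalar T z) : Set H)}

/-- `T - z I` is injective and its range is not dense. -/
def residualSpectrum (T : H →ₗ.[ℂ] H) : Set ℂ :=
  {z | kernel (subScalar T z) = ⊥ ∧ ¬ Dense (range (subScalar T z) : Set H)}

end Operators

/-! ### Rational symbols -/

/-- The function `R / S` on the torus; its values at the finitely many zeros of `S` are
irrelevant for the Toeplitz operator. -/
def rationalSymbol (R S : ℂ[X]) : UnitAddCircle → ℂ := fun x =>
  R.eval (AddCircle.toCircle x : ℂ) / S.eval (AddCircle.toCircle x : ℂ)

/-- The set of values of `R / S` on the unit circle, poles excluded. -/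
def symbolValues (R S : ℂ[X]) : Set ℂ :=
  rationalSymbol R S '' {x | S.eval (AddCircle.toCircle x : ℂ) ≠ 0}

open Classical in
/-- The monic polynomial whose zeros are those of `p` with modulus `< 1`, with the same
multiplicities; it is `0` for `p = 0`. -/
def inFactor (p : ℂ[X]) : ℂ[X] :=
  if p = 0 then 0 else ((p.roots.filter fun b => ‖b‖ < 1).map fun b => X - C b).prod

open Classical in
/-- The monic polynomial whose zeros are those of `p` with modulus `= 1`, with the same
multiplicities; it is `0` for `p = 0`. -/
def circleFactor (p : ℂ[X]) : ℂ[X] :=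
  if p = 0 then 0 else ((p.roots.filter fun b => ‖b‖ = 1).map fun b => X - C b).prod

/-- The product of the two previous factors: the zeros of `p` with modulus `≤ 1`. -/
def closedInFactor (p : ℂ[X]) : ℂ[X] := circleFactor p * inFactor p

end RationalToeplitz

end

open MeasureTheory Polynomial
open scoped ENNReal

noncomputable section

namespace RationalToeplitz

section

/-! ### Polynomials with zeros in a prescribed set -/

/-! Split the denominator as `S = qin * qp`, with the zeros of `qin` in the open disc and those of
`qp` outside it, and put n = deg `qin`. If ωu = h + g with h = P(ωu) and g orthogonal to H², then
`qin` g turns out to be a polynomial r of degree < n. So the graph of the operator is given by the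
polynomial relation S h = R u + `qp` r, with deg r < n. Subtracting λ only replaces R by p = R - λS,
and p stays coprime to S.

Coprimality turns the relation into u = `qp` w, `qin` h = p w + r (`mem_graph_iff_exists`). What
remains concerns polynomials in the unilateral shift M. The operator M - a is injective; it is
invertible for |a| > 1, has dense nonclosed range for |a| = 1, and has closed range of codimension
one for |a| < 1. Division with remainder by polynomials with zeros in the open disc gives:

The kernel is { `qp` w : p w is a polynomial of degree < n }. A zero of p in the closed disc must be
a zero of the polynomial p w, while the factor with zeros outside is invertible, so the dimension is
the truncated difference of n and the number of zeros of p in the closed disc (p ≠ 0).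

The cokernel is that of ran p(M) + {polynomials of degree < n}. Without zeros of p on the circle its
dimension is the opposite truncated difference. A zero on the circle makes it infinite dimensional
and destroys continuity of the inverse, but density of the range still depends only on the zeros in
the open disc. The seven statements compare these degrees; the case p = 0 is separate. -/

theorem polynomial_induction_on_roots {K : ℂ → Prop} {Φ : ℂ[X] → Prop}
    (hC : ∀ c : ℂ, c ≠ 0 → Φ (C c))
    (hmul : ∀ (a : ℂ) (s : ℂ[X]), K a → s ≠ 0 → Φ s → Φ ((X - C a) * s)) :
    ∀ s : ℂ[X], s ≠ 0 → (∀ z, s.IsRoot z → K z) → Φ s := by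
  suffices H : ∀ (n : ℕ) (s : ℂ[X]), s.natDegree = n → s ≠ 0 → (∀ z, s.IsRoot z → K z) → Φ s from
    fun s => H _ s rfl
  intro n
  induction n with
  | zero =>
    intro s hn hs _
    rw [eq_C_of_natDegree_eq_zero hn] at hs ⊢
    exact hC _ fun h => hs (by rw [h, C_0])
  | succ n ih =>
    intro s hn hs hK
    obtain ⟨a, ha⟩ := IsAlgClosed.exists_root s
      (fun h => by rw [natDegree_eq_of_degree_eq_some (n := 0) h] at hn; omega)
    obtain ⟨t, rfl⟩ := dvd_iff_isRoot.2 ha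
    have ht : t ≠ 0 := right_ne_zero_of_mul hs
    refine hmul a t (hK a ha) ht (ih t ?_ ht fun z hz => hK z ?_)
    · rw [natDegree_mul (X_sub_C_ne_zero a) ht, natDegree_X_sub_C] at hn
      omega
    · rw [IsRoot, eval_mul, hz.eq_zero, mul_zero]

/-! ### The unilateral shift -/

variable {H : Type*} [NormedAddCommGroup H] [InnerProductSpace ℂ H]

/-- The vector `r(M) e`, depending linearly on the polynomial `r`. -/
def polyVec (M : H →L[ℂ] H) (e : H) : ℂ[X] →ₗ[ℂ] H where
  toFun r := aeval M r e
  map_add' r s := by simp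
  map_smul' c r := by simp

theorem polyVec_mul (M : H →L[ℂ] H) (e : H) (r s : ℂ[X]) :
    polyVec M e (r * s) = aeval M r (polyVec M e s) := by
  simp [polyVec]

theorem polyVec_C (M : H →L[ℂ] H) (e : H) (c : ℂ) : polyVec M e (C c) = c • e := by
  simp [polyVec, Algebra.algebraMap_eq_smul_one]

theorem aeval_mul_apply (M : H →L[ℂ] H) (r s : ℂ[X]) (h : H) :
    aeval M (r * s) h = aeval M r (aeval M s h) := by
  simp

theorem aeval_comm_apply (M : H →L[ℂ] H) (r s : ℂ[X]) (h : H) :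
    aeval M r (aeval M s h) = aeval M s (aeval M r h) := by
  rw [← aeval_mul_apply, mul_comm, aeval_mul_apply]

theorem aeval_C_apply (M : H →L[ℂ] H) (c : ℂ) (h : H) : aeval M (C c) h = c • h := by
  simp [Algebra.algebraMap_eq_smul_one]

theorem aeval_X_sub_C_apply (M : H →L[ℂ] H) (a : ℂ) (h : H) :
    aeval M (X - C a) h = M h - a • h := by
  simp [Algebra.algebraMap_eq_smul_one]

variable [CompleteSpace H]

/-- `M` is an isometry, the orthogonal complement of its range is spanned by `e`, and the adjoint
of `M` has no eigenvalue of modulus at least `1`: the unilateral shift with vacuum vector `e`. -/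
structure IsUnilateralShift (M : H →L[ℂ] H) (e : H) : Prop where
  adjoint_apply_self : ∀ h, ContinuousLinearMap.adjoint M (M h) = h
  adjoint_vacuum : ContinuousLinearMap.adjoint M e = 0
  eq_smul_vacuum : ∀ h, ContinuousLinearMap.adjoint M h = 0 → ∃ c : ℂ, h = c • e
  vacuum_ne_zero : e ≠ 0
  eq_zero_of_adjoint_eq : ∀ (μ : ℂ) (v : H), 1 ≤ ‖μ‖ →
    ContinuousLinearMap.adjoint M v = μ • v → v = 0

namespace IsUnilateralShift

variable {M : H →L[ℂ] H} {e : H}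

theorem norm_apply (hM : IsUnilateralShift M e) (h : H) : ‖M h‖ = ‖h‖ := by
  have : inner ℂ (M h) (M h) = inner ℂ h h := by
    rw [← ContinuousLinearMap.adjoint_inner_left, hM.adjoint_apply_self]
  rw [inner_self_eq_norm_sq_to_K, inner_self_eq_norm_sq_to_K] at this
  exact (sq_eq_sq₀ (norm_nonneg _) (norm_nonneg _)).1 (by exact_mod_cast this)

theorem norm_le_one (hM : IsUnilateralShift M e) : ‖M‖ ≤ 1 :=
  M.opNorm_le_bound zero_le_one fun h => by rw [hM.norm_apply, one_mul]

theorem denseRange_sub (hM : IsUnilateralShift M e) {a : ℂ} (ha : 1 ≤ ‖a‖) :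
    DenseRange (aeval M (X - C a)) := by
  have key : (LinearMap.range (aeval M (X - C a)).toLinearMap)ᗮ = ⊥ := by
    rw [Submodule.eq_bot_iff]
    intro v hv
    refine hM.eq_zero_of_adjoint_eq (starRingEnd ℂ a) v (by simpa using ha) ?_
    rw [← sub_eq_zero]
    refine ext_inner_right ℂ fun h => ?_
    have h1 := (Submodule.mem_orthogonal' _ _).1 hv _ ⟨h, rfl⟩
    rw [ContinuousLinearMap.coe_coe, aeval_X_sub_C_apply, inner_sub_right, inner_smul_right] at h1
    rw [inner_sub_left, ContinuousLinearMap.adjoint_inner_left, inner_smul_left, inner_zero_left]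
    simpa using h1
  have := (Submodule.topologicalClosure_eq_top_iff).2 key
  exact Submodule.dense_iff_topologicalClosure_eq_top.2 this

/-- Applying the adjoint kills e and leaves w = a M* w. For a ≠ 0, w would be an eigenvector of M*
for 1/a, of modulus at least 1. With c = 0 this is injectivity of M - a; with c ≠ 0 it keeps e out
of the range. -/
theorem eq_zero_of_sub_eq_smul (hM : IsUnilateralShift M e) {a : ℂ} (ha : ‖a‖ ≤ 1) {w : H} {c : ℂ}
    (hw : aeval M (X - C a) w = c • e) : w = 0 := by
  have h1 := congrArg (ContinuousLinearMap.adjoint M) hw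
  rw [aeval_X_sub_C_apply, map_sub, hM.adjoint_apply_self, map_smul, map_smul, hM.adjoint_vacuum,
    smul_zero, sub_eq_zero] at h1
  rcases eq_or_ne a 0 with rfl | h0
  · simpa using h1
  · refine hM.eq_zero_of_adjoint_eq a⁻¹ w ?_ ?_
    · rw [norm_inv]
      exact (one_le_inv₀ (norm_pos_iff.2 h0)).2 ha
    · conv_rhs => rw [h1]
      rw [smul_smul, inv_mul_cancel₀ h0, one_smul]

theorem isUnit_sub (hM : IsUnilateralShift M e) {a : ℂ} (ha : 1 < ‖a‖) :
    IsUnit (aeval M (X - C a)) := by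
  have h0 : a ≠ 0 := norm_pos_iff.1 (zero_lt_one.trans ha)
  have h1 : ‖a⁻¹ • M‖ < 1 := by
    rw [norm_smul, norm_inv]
    calc ‖a‖⁻¹ * ‖M‖ ≤ ‖a‖⁻¹ * 1 := by gcongr; exact hM.norm_le_one
      _ < 1 := by rw [mul_one]; exact inv_lt_one_of_one_lt₀ ha
  have h2 : IsUnit (1 - a⁻¹ • M) := isUnit_one_sub_of_norm_lt_one h1
  have h3 : aeval M (X - C a) = algebraMap ℂ (H →L[ℂ] H) (-a) * (1 - a⁻¹ • M) := by
    ext h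
    simp [Algebra.algebraMap_eq_smul_one, smul_sub, h0]
  rw [h3]
  exact ((IsUnit.mk0 _ (neg_ne_zero.2 h0)).map (algebraMap ℂ (H →L[ℂ] H))).mul h2

/-- M*(M - a) = 1 - aM* is invertible by a Neumann series, so Q = (1 - aM*)⁻¹M* is a left inverse.
The error h - (M - a)Qh is killed by M*, hence is a multiple of e. -/
theorem exists_leftInverse_sub (hM : IsUnilateralShift M e) {a : ℂ} (ha : ‖a‖ < 1) :
    ∃ Q : H →L[ℂ] H, (∀ h, Q (aeval M (X - C a) h) = h) ∧
      ∀ h, ∃ c : ℂ, h = aeval M (X - C a) (Q h) + c • e := by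
  have h1 : ‖a • ContinuousLinearMap.adjoint M‖ < 1 := by
    rw [norm_smul, LinearIsometryEquiv.norm_map]
    calc ‖a‖ * ‖M‖ ≤ ‖a‖ * 1 := by gcongr; exact hM.norm_le_one
      _ < 1 := by rwa [mul_one]
  obtain ⟨u, hu⟩ : IsUnit (1 - a • ContinuousLinearMap.adjoint M) :=
    isUnit_one_sub_of_norm_lt_one h1
  have hu' : ∀ h, (u : H →L[ℂ] H) h = h - a • ContinuousLinearMap.adjoint M h := fun h => by
    rw [hu]; simp
  have hinv : ∀ h, (↑u⁻¹ : H →L[ℂ] H) ((u : H →L[ℂ] H) h) = h := fun h => by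
    rw [← mul_apply_eq_comp, Units.inv_mul, one_apply_eq_self]
  have hinv' : ∀ h, (u : H →L[ℂ] H) ((↑u⁻¹ : H →L[ℂ] H) h) = h := fun h => by
    rw [← mul_apply_eq_comp, Units.mul_inv, one_apply_eq_self]
  have hadj : ∀ h, ContinuousLinearMap.adjoint M (aeval M (X - C a) h) = (u : H →L[ℂ] H) h := by
    intro h
    rw [aeval_X_sub_C_apply, map_sub, hM.adjoint_apply_self, map_smul, hu']
  refine ⟨(↑u⁻¹ : H →L[ℂ] H) ∘L ContinuousLinearMap.adjoint M, fun h => ?_, fun h => ?_⟩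
  · rw [ContinuousLinearMap.comp_apply, hadj, hinv]
  · obtain ⟨c, hc⟩ := hM.eq_smul_vacuum
      (h - aeval M (X - C a) ((↑u⁻¹ : H →L[ℂ] H) (ContinuousLinearMap.adjoint M h)))
      (by rw [map_sub, hadj, hinv', sub_self])
    exact ⟨c, by rw [ContinuousLinearMap.comp_apply, ← hc]; abel⟩

/-! ### Polynomials of the shift -/

theorem denseRange_aeval (hM : IsUnilateralShift M e) {s : ℂ[X]} (hs : s ≠ 0)
    (hr : ∀ z, s.IsRoot z → 1 ≤ ‖z‖) : DenseRange (aeval M s) := by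
  refine polynomial_induction_on_roots (K := fun z => 1 ≤ ‖z‖)
    (Φ := fun s => DenseRange (aeval M s)) (fun c hc => ?_) (fun a s ha _ ih => ?_) s hs hr
  · refine Function.Surjective.denseRange fun h => ⟨c⁻¹ • h, ?_⟩
    rw [aeval_C_apply, smul_smul, mul_inv_cancel₀ hc, one_smul]
  · have := (hM.denseRange_sub ha).comp ih (aeval M (X - C a)).continuous
    rw [map_mul]
    exact this

theorem isUnit_aeval (hM : IsUnilateralShift M e) {s : ℂ[X]} (hs : s ≠ 0)
    (hr : ∀ z, s.IsRoot z → 1 < ‖z‖) : IsUnit (aeval M s) := by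
  refine polynomial_induction_on_roots (K := fun z => 1 < ‖z‖)
    (Φ := fun s => IsUnit (aeval M s)) (fun c hc => ?_) (fun a s ha _ ih => ?_) s hs hr
  · rw [aeval_C]
    exact (IsUnit.mk0 c hc).map _
  · rw [map_mul]
    exact (hM.isUnit_sub ha).mul ih

/-- A polynomial divisible by s inside H is already divisible by s as a polynomial. For one zero a,
write r = (X - a)q + r(a); then r(a)e lies in the range of M - a, which forces r(a) = 0. -/
theorem exists_factor_of_aeval_eq_polyVec (hM : IsUnilateralShift M e) {s : ℂ[X]} (hs : s ≠ 0)
    (hr : ∀ z, s.IsRoot z → ‖z‖ ≤ 1) {w : H} {r : ℂ[X]} (h : aeval M s w = polyVec M e r) :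
    ∃ t, r = s * t ∧ w = polyVec M e t := by
  revert w r
  refine polynomial_induction_on_roots (K := fun z => ‖z‖ ≤ 1)
    (Φ := fun s => ∀ {w : H} {r : ℂ[X]}, aeval M s w = polyVec M e r →
      ∃ t, r = s * t ∧ w = polyVec M e t) (fun c hc w r h => ?_) (fun a s ha _ ih w r h => ?_) s hs hr
  · refine ⟨C c⁻¹ * r, ?_, ?_⟩
    · rw [← mul_assoc, ← C_mul, mul_inv_cancel₀ hc, C_1, one_mul]
    · rw [polyVec_mul, ← h, aeval_C_apply, aeval_C_apply, smul_smul, inv_mul_cancel₀ hc, one_smul]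
  · rw [aeval_mul_apply] at h
    have hdiv : r = (X - C a) * (r /ₘ (X - C a)) + C (r.eval a) := by
      conv_lhs => rw [← modByMonic_add_div r (X - C a), modByMonic_X_sub_C_eq_C_eval, add_comm]
    have h0 : aeval M (X - C a) (aeval M s w - polyVec M e (r /ₘ (X - C a))) = r.eval a • e := by
      rw [map_sub, h, ← polyVec_mul, ← map_sub, ← polyVec_C M]
      congr 1
      rw [sub_eq_iff_eq_add', ← hdiv]
    have h1 := hM.eq_zero_of_sub_eq_smul ha h0
    rw [h1, map_zero, eq_comm, smul_eq_zero, or_iff_left hM.vacuum_ne_zero] at h0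
    obtain ⟨t, ht, hw⟩ := ih (sub_eq_zero.1 h1)
    refine ⟨t, ?_, hw⟩
    rw [hdiv, h0, C_0, add_zero, ht, mul_assoc]

theorem polyVec_injective (hM : IsUnilateralShift M e) : Function.Injective (polyVec M e) := by
  refine (injective_iff_map_eq_zero _).2 fun r hr => ?_
  by_contra h0
  -- If r(M)e = 0, then r is divisible by a power of X exceeding its degree.
  obtain ⟨t, ht, -⟩ := hM.exists_factor_of_aeval_eq_polyVec (s := X ^ (r.natDegree + 1)) (w := 0)
    (r := r) (pow_ne_zero _ X_ne_zero) (fun z hz => by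
      rw [IsRoot, eval_pow, eval_X] at hz
      rw [pow_eq_zero_iff (by omega)] at hz
      simp [hz]) (by rw [map_zero, hr])
  have ht0 : t ≠ 0 := by rintro rfl; exact h0 (by rw [ht, mul_zero])
  have := congrArg natDegree ht
  rw [natDegree_mul (pow_ne_zero _ X_ne_zero) ht0, natDegree_X_pow] at this
  omega

theorem aeval_injective (hM : IsUnilateralShift M e) {s : ℂ[X]} (hs : s ≠ 0) :
    Function.Injective (aeval M s) := by
  refine polynomial_induction_on_roots (K := fun _ => True)
    (Φ := fun s => Function.Injective (aeval M s)) (fun c hc => ?_) (fun a s _ _ ih => ?_) s hs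
    (fun _ _ => trivial)
  · refine (injective_iff_map_eq_zero _).2 fun h hh => ?_
    rw [aeval_C_apply] at hh
    exact (smul_eq_zero.1 hh).resolve_left hc
  · have h1 : Function.Injective (aeval M (X - C a)) := by
      rcases le_or_gt ‖a‖ 1 with ha | ha
      · refine (injective_iff_map_eq_zero _).2 fun h hh => ?_
        exact hM.eq_zero_of_sub_eq_smul ha (c := 0) (by rw [hh, zero_smul])
      · obtain ⟨u, hu⟩ := hM.isUnit_sub ha
        refine Function.LeftInverse.injective (g := (↑u⁻¹ : H →L[ℂ] H)) fun h => ?_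
        rw [← hu, ← mul_apply_eq_comp, Units.inv_mul, one_apply_eq_self]
    rw [map_mul]
    exact h1.comp ih

/-- Division with remainder in H, with a continuous quotient: one zero at a time, each contributing
one constant to the remainder. -/
theorem exists_division (hM : IsUnilateralShift M e) {s : ℂ[X]} (hs : s ≠ 0)
    (hr : ∀ z, s.IsRoot z → ‖z‖ < 1) :
    ∃ Q : H →L[ℂ] H, (∀ h, Q (aeval M s h) = h) ∧
      ∀ h, ∃ r ∈ degreeLT ℂ s.natDegree, h = aeval M s (Q h) + polyVec M e r := by
  refine polynomial_induction_on_roots (K := fun z => ‖z‖ < 1)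
    (Φ := fun s => ∃ Q : H →L[ℂ] H, (∀ h, Q (aeval M s h) = h) ∧
      ∀ h, ∃ r ∈ degreeLT ℂ s.natDegree, h = aeval M s (Q h) + polyVec M e r)
    (fun c hc => ?_) (fun a s ha hs ih => ?_) s hs hr
  · refine ⟨c⁻¹ • ContinuousLinearMap.id ℂ H, fun h => ?_, fun h => ⟨0, Submodule.zero_mem _, ?_⟩⟩
    · simp [aeval_C_apply, smul_smul, mul_inv_cancel₀ hc, -aeval_C]
    · simp [aeval_C_apply, smul_smul, inv_mul_cancel₀ hc, -aeval_C]
  · obtain ⟨Q₁, hQ₁, hd₁⟩ := hM.exists_leftInverse_sub ha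
    obtain ⟨Q, hQ, hd⟩ := ih
    refine ⟨Q ∘L Q₁, fun h => ?_, fun h => ?_⟩
    · rw [ContinuousLinearMap.comp_apply, aeval_mul_apply, hQ₁, hQ]
    · obtain ⟨c, hc⟩ := hd₁ h
      obtain ⟨r, hr, hr'⟩ := hd (Q₁ h)
      refine ⟨(X - C a) * r + C c, ?_, ?_⟩
      · rw [natDegree_mul (X_sub_C_ne_zero a) hs, natDegree_X_sub_C]
        rw [mem_degreeLT] at hr
        refine Submodule.add_mem _ (mem_degreeLT.2 ?_) (mem_degreeLT.2 ?_)
        · rcases eq_or_ne r 0 with rfl | h0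
          · rw [mul_zero, degree_zero]; exact WithBot.bot_lt_coe _
          · rw [degree_mul, degree_X_sub_C, degree_eq_natDegree h0] at *
            norm_cast at hr ⊢
            omega
        · refine degree_C_le.trans_lt ?_
          norm_cast
          omega
      · conv_lhs => rw [hc]
        rw [ContinuousLinearMap.comp_apply, aeval_mul_apply, map_add, polyVec_C, polyVec_mul,
          ← add_assoc, ← map_add, ← hr']

end IsUnilateralShift

end

/-! ### Ranges of polynomials of the shift, enlarged by polynomial vectors -/

section

variable {H : Type*} [NormedAddCommGroup H] [InnerProductSpace ℂ H]

/-- The vectors `r(M) e` with `deg r < n`. -/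
def polyLT (M : H →L[ℂ] H) (e : H) (n : ℕ) : Submodule ℂ H := (degreeLT ℂ n).map (polyVec M e)

instance (n : ℕ) : FiniteDimensional ℂ (degreeLT ℂ n) :=
  (degreeLTEquiv ℂ n).symm.finiteDimensional

instance (M : H →L[ℂ] H) (e : H) (n : ℕ) : FiniteDimensional ℂ (polyLT M e n) :=
  inferInstanceAs (FiniteDimensional ℂ ((degreeLT ℂ n).map (polyVec M e)))

theorem finrank_map_degreeLT (n : ℕ) {J : ℂ[X] →ₗ[ℂ] H} (hJ : Function.Injective J) :
    Module.finrank ℂ ((degreeLT ℂ n).map J) = n := by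
  rw [← ((degreeLT ℂ n).equivMapOfInjective J hJ).finrank_eq, (degreeLTEquiv ℂ n).finrank_eq,
    Module.finrank_fin_fun]

theorem mem_map_kernel_iff {T : H →ₗ.[ℂ] H} {u : H} :
    u ∈ (kernel T).map T.domain.subtype ↔ (u, (0 : H)) ∈ T.graph := by
  rw [LinearPMap.mem_graph_iff]
  constructor
  · rintro ⟨v, hv, rfl⟩
    exact ⟨v, rfl, hv⟩
  · rintro ⟨v, rfl, hv⟩
    exact ⟨v, hv, rfl⟩

theorem range_aeval_mul_isUnit {M : H →L[ℂ] H} {s t : ℂ[X]} (ht : IsUnit (aeval M t)) :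
    (aeval M (s * t)).range = (aeval M s).range := by
  obtain ⟨v, hv⟩ := ht
  ext h
  constructor
  · rintro ⟨w, rfl⟩
    exact ⟨aeval M t w, (aeval_mul_apply M s t w).symm⟩
  · rintro ⟨w, rfl⟩
    refine ⟨(↑v⁻¹ : H →L[ℂ] H) w, ?_⟩
    change aeval M (s * t) _ = aeval M s w
    rw [aeval_mul_apply, ← hv, ← mul_apply_eq_comp (v : H →L[ℂ] H), Units.mul_inv,
      one_apply_eq_self]

variable [CompleteSpace H]

/-- The range has finite codimension, so any algebraic complement is finite dimensional, hence
closed; a bounded injective operator whose range has a closed complement has closed range. -/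
theorem isClosed_range_of_sup_eq_top {N : H →L[ℂ] H} (hN : Function.Injective N)
    {F : Submodule ℂ H} [FiniteDimensional ℂ F] (hF : N.range ⊔ F = ⊤) :
    IsClosed (N.range : Set H) := by
  obtain ⟨G, hG⟩ := N.range.exists_isCompl
  have hsurj : Function.Surjective (N.range.mkQ ∘ₗ F.subtype) := by
    rw [← LinearMap.range_eq_top, LinearMap.range_comp, Submodule.range_subtype]
    have := congrArg (Submodule.map N.range.mkQ) hF
    rwa [Submodule.map_sup, Submodule.mkQ_map_self, bot_sup_eq, Submodule.map_top,
      Submodule.range_mkQ] at this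
  have : FiniteDimensional ℂ (H ⧸ N.range) := Module.Finite.of_surjective _ hsurj
  have : FiniteDimensional ℂ G := (N.range.quotientEquivOfIsCompl G hG).finiteDimensional
  exact N.closed_complemented_range_of_isCompl_of_ker_eq_bot G hG
    G.closed_of_finiteDimensional (LinearMap.ker_eq_bot.2 hN)

namespace IsUnilateralShift

variable {M : H →L[ℂ] H} {e : H}

theorem vacuum_notMem_range (hM : IsUnilateralShift M e) {a : ℂ} (ha : ‖a‖ = 1) :
    e ∉ (aeval M (X - C a)).range := by
  rintro ⟨w, hw⟩
  have hw : aeval M (X - C a) w = (1 : ℂ) • e := by rw [one_smul]; exact hw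
  rw [hM.eq_zero_of_sub_eq_smul ha.le hw, map_zero, one_smul] at hw
  exact hM.vacuum_ne_zero hw.symm

theorem not_isClosed_range_sub (hM : IsUnilateralShift M e) {a : ℂ} (ha : ‖a‖ = 1) :
    ¬ IsClosed ((aeval M (X - C a)).range : Set H) := by
  intro hcl
  refine hM.vacuum_notMem_range ha ?_
  have h1 := (hM.denseRange_sub ha.ge).closure_range
  have h2 := hcl.closure_eq
  rw [LinearMap.coe_range, ContinuousLinearMap.coe_coe, h1] at h2
  have : e ∈ (Set.univ : Set H) := trivial
  rw [h2] at this
  exact this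

theorem isClosed_range_aeval (hM : IsUnilateralShift M e) {s : ℂ[X]} (hs : s ≠ 0)
    (hr : ∀ z, s.IsRoot z → ‖z‖ < 1) : IsClosed ((aeval M s).range : Set H) := by
  obtain ⟨Q, hQ, -⟩ := hM.exists_division hs hr
  -- The range is the fixed-point set of the continuous map s(M)Q.
  have : ((aeval M s).range : Set H) = {h | aeval M s (Q h) = h} := by
    ext h
    refine ⟨?_, fun hh => ⟨Q h, hh⟩⟩
    rintro ⟨w, rfl⟩
    exact congrArg _ (hQ w)
  rw [this]
  exact isClosed_eq (by fun_prop) continuous_id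

theorem range_aeval_sup_polyLT (hM : IsUnilateralShift M e) {s : ℂ[X]} (hs : s ≠ 0)
    (hr : ∀ z, s.IsRoot z → ‖z‖ < 1) : (aeval M s).range ⊔ polyLT M e s.natDegree = ⊤ := by
  obtain ⟨Q, -, hd⟩ := hM.exists_division hs hr
  refine Submodule.eq_top_iff'.2 fun h => ?_
  obtain ⟨r, hr, h'⟩ := hd h
  rw [h']
  exact Submodule.add_mem_sup ⟨_, rfl⟩ ⟨r, hr, rfl⟩

/-- Modulo ran s(M) every vector is a polynomial of degree < deg s, and those of degree < n are
already present; the span of Xⁿ, …, X^(deg s - 1) remains. Truncated subtraction makes it zero when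
n ≥ deg s. -/
theorem isCompl_range_sup_polyLT (hM : IsUnilateralShift M e) {s : ℂ[X]} (hs : s ≠ 0)
    (hr : ∀ z, s.IsRoot z → ‖z‖ < 1) (n : ℕ) :
    IsCompl ((aeval M s).range ⊔ polyLT M e n)
      ((degreeLT ℂ (s.natDegree - n)).map (polyVec M e ∘ₗ LinearMap.mulLeft ℂ (X ^ n))) := by
  constructor
  · rw [Submodule.disjoint_def]
    intro x hx hx'
    obtain ⟨_, ⟨w, rfl⟩, _, ⟨r, hr', rfl⟩, rfl⟩ := Submodule.mem_sup.1 hx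
    obtain ⟨t, ht, ht'⟩ := hx'
    have hw : aeval M s w = polyVec M e (X ^ n * t - r) := by
      rw [map_sub, eq_sub_iff_add_eq]
      exact ht'.symm
    obtain ⟨v, hv, -⟩ := hM.exists_factor_of_aeval_eq_polyVec hs (fun z hz => (hr z hz).le) hw
    rw [SetLike.mem_coe, mem_degreeLT] at ht hr'
    suffices t = 0 by rw [← ht', this, map_zero]
    by_contra h0
    rw [degree_eq_natDegree h0] at ht
    norm_cast at ht
    have hd : (X ^ n * t).degree = ((n + t.natDegree : ℕ) : WithBot ℕ) := by
      rw [degree_mul, degree_X_pow, degree_eq_natDegree h0]; push_cast; rfl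
    have hlt : r.degree < (X ^ n * t).degree := by
      rw [hd]
      exact hr'.trans_le (by norm_cast; omega)
    -- The multiple s v of s would have degree n + deg t < deg s.
    have hd' := degree_sub_eq_left_of_degree_lt hlt
    rw [hv, hd] at hd'
    have hv0 : v ≠ 0 := by
      rintro rfl
      rw [mul_zero, degree_zero] at hd'
      exact WithBot.bot_ne_coe hd'
    rw [degree_mul, degree_eq_natDegree hs, degree_eq_natDegree hv0] at hd'
    norm_cast at hd'
    omega
  · rw [codisjoint_iff, Submodule.eq_top_iff']
    intro h
    have : h ∈ (aeval M s).range ⊔ polyLT M e s.natDegree := by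
      rw [hM.range_aeval_sup_polyLT hs hr]; trivial
    obtain ⟨x, hx, _, ⟨r, hr', rfl⟩, rfl⟩ := Submodule.mem_sup.1 this
    have hX : (X ^ n : ℂ[X]).Monic := monic_X_pow n
    rw [← modByMonic_add_div r (X ^ n), map_add, ← add_assoc]
    refine Submodule.add_mem_sup (Submodule.add_mem_sup hx ⟨_, ?_, rfl⟩) ⟨r /ₘ X ^ n, ?_, rfl⟩
    · rw [SetLike.mem_coe, mem_degreeLT]
      simpa using degree_modByMonic_lt r hX
    · rw [SetLike.mem_coe, mem_degreeLT] at hr' ⊢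
      rcases eq_or_ne (r /ₘ X ^ n) 0 with h0 | h0
      · rw [h0, degree_zero]; exact WithBot.bot_lt_coe _
      · have h1 : ¬ r.degree < (X ^ n : ℂ[X]).degree := fun h1 => h0 ((divByMonic_eq_zero_iff hX).2 h1)
        have hr0 : r ≠ 0 := by rintro rfl; simp at h0
        rw [degree_X_pow, degree_eq_natDegree hr0] at h1
        rw [degree_eq_natDegree hr0] at hr'
        rw [degree_eq_natDegree h0, natDegree_divByMonic r hX, natDegree_X_pow]
        norm_cast at h1 hr' ⊢
        omega

theorem finrank_quotient_range_sup_polyLT (hM : IsUnilateralShift M e) {s : ℂ[X]} (hs : s ≠ 0)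
    (hr : ∀ z, s.IsRoot z → ‖z‖ < 1) (n : ℕ) :
    FiniteDimensional ℂ (H ⧸ ((aeval M s).range ⊔ polyLT M e n)) ∧
    Module.finrank ℂ (H ⧸ ((aeval M s).range ⊔ polyLT M e n)) = s.natDegree - n := by
  have E := Submodule.quotientEquivOfIsCompl _ _ (hM.isCompl_range_sup_polyLT hs hr n)
  refine ⟨E.symm.finiteDimensional, ?_⟩
  rw [E.finrank_eq, finrank_map_degreeLT]
  exact hM.polyVec_injective.comp (mul_right_injective₀ (pow_ne_zero _ X_ne_zero))

/-- Since ran p(M) ⊆ ran(M - a), finite codimension would pass to ran(M - a) and make it closed. -/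
theorem not_finite_quotient_range_sup_polyLT (hM : IsUnilateralShift M e) {p : ℂ[X]} {a : ℂ}
    (ha : ‖a‖ = 1) (hp : p.IsRoot a) (n : ℕ) :
    ¬ FiniteDimensional ℂ (H ⧸ ((aeval M p).range ⊔ polyLT M e n)) := by
  intro hfin
  obtain ⟨G, hG⟩ := ((aeval M p).range ⊔ polyLT M e n).exists_isCompl
  have : FiniteDimensional ℂ G := (Submodule.quotientEquivOfIsCompl _ G hG).finiteDimensional
  refine hM.not_isClosed_range_sub ha (isClosed_range_of_sup_eq_top
    (hM.aeval_injective (X_sub_C_ne_zero a)) (F := polyLT M e n ⊔ G) ?_)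
  rw [← sup_assoc, eq_top_iff, ← hG.sup_eq_top]
  gcongr
  obtain ⟨t, rfl⟩ := dvd_iff_isRoot.2 hp
  rintro _ ⟨w, rfl⟩
  exact ⟨aeval M t w, (aeval_mul_apply M _ _ w).symm⟩

end IsUnilateralShift

/-! ### Operators whose graph is that of a Toeplitz operator with rational symbol -/

/-- `T` has the graph of the Toeplitz operator with symbol `p / (qin * qp)`, for a unilateral shift
`M` with vacuum vector `e`; `qin` and `qp` carry the zeros of the denominator inside and outside
the open unit disc. -/
structure HasRationalSymbol (M : H →L[ℂ] H) (e : H) (p qin qp : ℂ[X]) (T : H →ₗ.[ℂ] H) : Prop where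
  shift : IsUnilateralShift M e
  coprime : IsCoprime p (qin * qp)
  qin_ne_zero : qin ≠ 0
  qp_ne_zero : qp ≠ 0
  norm_lt_one : ∀ z, qin.IsRoot z → ‖z‖ < 1
  one_le_norm : ∀ z, qp.IsRoot z → 1 ≤ ‖z‖
  mem_graph_iff : ∀ u h, (u, h) ∈ T.graph ↔ ∃ r ∈ degreeLT ℂ qin.natDegree,
    aeval M (qin * qp) h = aeval M p u + aeval M qp (polyVec M e r)

namespace HasRationalSymbol

variable {M : H →L[ℂ] H} {e : H} {p qin qp : ℂ[X]} {T : H →ₗ.[ℂ] H}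

/-- From p u = `qp`(`qin` h - r) and a Bézout relation x p + y `qp` = 1, u = `qp` w with w = x(`qin`
h - r) + y u. Injectivity of `qp`(M) then cancels that factor. -/
theorem mem_graph_iff_exists (hT : HasRationalSymbol M e p qin qp T) (u h : H) :
    (u, h) ∈ T.graph ↔ ∃ w, u = aeval M qp w ∧ ∃ r ∈ degreeLT ℂ qin.natDegree,
      aeval M qin h = aeval M p w + polyVec M e r := by
  rw [hT.mem_graph_iff]
  constructor
  · rintro ⟨r, hr, h1⟩
    obtain ⟨x, y, hxy⟩ := hT.coprime.of_mul_right_right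
    have h2 : aeval M p u = aeval M qp (aeval M qin h - polyVec M e r) := by
      rw [map_sub, ← aeval_mul_apply, mul_comm qp, h1, add_sub_cancel_right]
    have h3 : u = aeval M qp (aeval M x (aeval M qin h - polyVec M e r) + aeval M y u) := by
      rw [map_add, aeval_comm_apply M qp x, ← h2, aeval_comm_apply M qp y, ← aeval_mul_apply,
        ← aeval_mul_apply, ← add_apply, ← map_add, hxy, map_one,
        one_apply_eq_self]
    refine ⟨_, h3, r, hr, ?_⟩
    refine hT.shift.aeval_injective hT.qp_ne_zero ?_
    rw [map_add, aeval_comm_apply M qp p, ← h3, ← h1, mul_comm, aeval_mul_apply]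
  · rintro ⟨w, rfl, r, hr, h1⟩
    exact ⟨r, hr, by rw [mul_comm, aeval_mul_apply, h1, map_add, aeval_comm_apply M p]⟩

theorem mem_range_iff (hT : HasRationalSymbol M e p qin qp T) (h : H) :
    h ∈ range T ↔ ∃ w, ∃ r ∈ degreeLT ℂ qin.natDegree,
      aeval M qin h = aeval M p w + polyVec M e r := by
  have : h ∈ range T ↔ ∃ u, (u, h) ∈ T.graph := LinearPMap.mem_range_iff
  rw [this]
  constructor
  · rintro ⟨u, hu⟩
    obtain ⟨w, -, h1⟩ := (hT.mem_graph_iff_exists u h).1 hu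
    exact ⟨w, h1⟩
  · rintro ⟨w, h1⟩
    exact ⟨_, (hT.mem_graph_iff_exists _ h).2 ⟨w, rfl, h1⟩⟩

theorem range_eq_comap (hT : HasRationalSymbol M e p qin qp T) :
    range T = ((aeval M p).range ⊔ polyLT M e qin.natDegree).comap (aeval M qin).toLinearMap := by
  ext h
  rw [hT.mem_range_iff, Submodule.mem_comap, Submodule.mem_sup]
  constructor
  · rintro ⟨w, r, hr, h1⟩
    exact ⟨_, ⟨w, rfl⟩, _, ⟨r, hr, rfl⟩, h1.symm⟩
  · rintro ⟨_, ⟨w, rfl⟩, _, ⟨r, hr, rfl⟩, h1⟩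
    exact ⟨w, r, hr, h1.symm⟩

/-- The cokernel of `T` is the quotient by the range of `p(M)` and the vectors `r(M) e` with
`deg r < deg qin`. -/
def cokernelEquiv (hT : HasRationalSymbol M e p qin qp T) :
    (H ⧸ range T) ≃ₗ[ℂ] H ⧸ ((aeval M p).range ⊔ polyLT M e qin.natDegree) :=
  (Submodule.quotEquivOfEq _ _ (by
    rw [hT.range_eq_comap, LinearMap.ker_comp, Submodule.ker_mkQ])).trans
  -- Onto because ran `qin`(M) and the polynomials of degree < deg `qin` together span H.
  (LinearMap.quotKerEquivOfSurjective
    (((aeval M p).range ⊔ polyLT M e qin.natDegree).mkQ ∘ₗ (aeval M qin).toLinearMap) (by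
      rw [← LinearMap.range_eq_top, LinearMap.range_comp]
      have h1 := congrArg (Submodule.map ((aeval M p).range ⊔ polyLT M e qin.natDegree).mkQ)
        (hT.shift.range_aeval_sup_polyLT hT.qin_ne_zero hT.norm_lt_one)
      have h2 : (polyLT M e qin.natDegree).map
          ((aeval M p).range ⊔ polyLT M e qin.natDegree).mkQ = ⊥ := by
        rw [← le_bot_iff, Submodule.map_le_iff_le_comap, ← LinearMap.ker, Submodule.ker_mkQ]
        exact le_sup_right
      rwa [Submodule.map_sup, h2, sup_bot_eq, Submodule.map_top, Submodule.range_mkQ] at h1))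

/-- The graph is the preimage of a finite-dimensional subspace under a continuous map. -/
theorem isClosed (hT : HasRationalSymbol M e p qin qp T) : T.IsClosed := by
  have : (T.graph : Set (H × H)) =
      (fun x : H × H => aeval M (qin * qp) x.2 - aeval M p x.1) ⁻¹'
        ((polyLT M e qin.natDegree).map (aeval M qp).toLinearMap : Submodule ℂ H) := by
    ext ⟨u, h⟩
    rw [SetLike.mem_coe, hT.mem_graph_iff]
    constructor
    · rintro ⟨r, hr, h1⟩
      exact ⟨_, ⟨r, hr, rfl⟩, (sub_eq_iff_eq_add'.2 h1).symm⟩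
    · rintro ⟨_, ⟨r, hr, rfl⟩, h1⟩
      exact ⟨r, hr, sub_eq_iff_eq_add'.1 h1.symm⟩
  rw [LinearPMap.IsClosed, this]
  exact (Submodule.closed_of_finiteDimensional _).preimage (by fun_prop)

/-- The domain contains the dense range of `qp`(M): dividing p w by `qin` supplies h and r for every
w. -/
theorem dense_domain (hT : HasRationalSymbol M e p qin qp T) : Dense (T.domain : Set H) := by
  refine (hT.shift.denseRange_aeval hT.qp_ne_zero hT.one_le_norm).mono ?_
  rintro _ ⟨w, rfl⟩
  obtain ⟨Q, -, hd⟩ := hT.shift.exists_division hT.qin_ne_zero hT.norm_lt_one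
  obtain ⟨r, hr, h1⟩ := hd (aeval M p w)
  refine LinearPMap.mem_domain_iff.2 ⟨Q (aeval M p w),
    (hT.mem_graph_iff_exists _ _).2 ⟨w, rfl, -r, Submodule.neg_mem _ hr, ?_⟩⟩
  rw [map_neg, ← sub_eq_add_neg, eq_sub_iff_add_eq, ← h1]

theorem finrank_kernel (hT : HasRationalSymbol M e p qin qp T) {s t : ℂ[X]} (hp : p = s * t)
    (hs : s ≠ 0) (ht : t ≠ 0) (hs' : ∀ z, s.IsRoot z → ‖z‖ ≤ 1) (ht' : ∀ z, t.IsRoot z → 1 < ‖z‖) :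
    FiniteDimensional ℂ (kernel T) ∧
    Module.finrank ℂ (kernel T) = qin.natDegree - s.natDegree := by
  obtain ⟨v, hv⟩ := hT.shift.isUnit_aeval ht ht'
  have hv1 : ∀ h, aeval M t ((↑v⁻¹ : H →L[ℂ] H) h) = h := fun h => by
    rw [← hv, ← mul_apply_eq_comp, Units.mul_inv, one_apply_eq_self]
  have hv2 : Function.Injective (↑v⁻¹ : H →L[ℂ] H) := fun x y hxy => by
    rw [← hv1 x, hxy, hv1]
  -- Kernel vectors are `qp` w with s t w = -r; divisibility by s gives t w = x, a polynomial with
  -- deg(s x) < deg `qin`.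
  let J : ℂ[X] →ₗ[ℂ] H := (aeval M qp ∘L (↑v⁻¹ : H →L[ℂ] H)).toLinearMap ∘ₗ polyVec M e
  have hJ : Function.Injective J :=
    ((hT.shift.aeval_injective hT.qp_ne_zero).comp hv2).comp hT.shift.polyVec_injective
  have key : (kernel T).map T.domain.subtype =
      (degreeLT ℂ (qin.natDegree - s.natDegree)).map J := by
    ext u
    rw [mem_map_kernel_iff, hT.mem_graph_iff_exists]
    constructor
    · rintro ⟨w, rfl, r, hr, h1⟩
      rw [map_zero, hp, aeval_mul_apply, eq_comm, ← eq_neg_iff_add_eq_zero, ← map_neg] at h1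
      obtain ⟨x, hx, hw⟩ := hT.shift.exists_factor_of_aeval_eq_polyVec hs hs' h1
      refine ⟨x, ?_, ?_⟩
      · rw [mem_degreeLT, ← degree_neg, hx, degree_mul, degree_eq_natDegree hs] at hr
        rw [SetLike.mem_coe, mem_degreeLT]
        rcases eq_or_ne x 0 with rfl | h0
        · rw [degree_zero]; exact WithBot.bot_lt_coe _
        · rw [degree_eq_natDegree h0] at hr ⊢
          norm_cast at hr ⊢
          omega
      · change aeval M qp ((↑v⁻¹ : H →L[ℂ] H) (polyVec M e x)) = _
        rw [← hw, ← hv, ← mul_apply_eq_comp (↑v⁻¹ : H →L[ℂ] H), Units.inv_mul, one_apply_eq_self]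
    · rintro ⟨x, hx, rfl⟩
      refine ⟨(↑v⁻¹ : H →L[ℂ] H) (polyVec M e x), rfl, -(s * x), ?_, ?_⟩
      · rw [SetLike.mem_coe, mem_degreeLT] at hx
        rw [mem_degreeLT, degree_neg]
        rcases eq_or_ne x 0 with rfl | h0
        · rw [mul_zero, degree_zero]; exact WithBot.bot_lt_coe _
        · rw [degree_mul, degree_eq_natDegree hs]
          rw [degree_eq_natDegree h0] at hx ⊢
          norm_cast at hx ⊢
          omega
      · rw [map_zero, hp, aeval_mul_apply, hv1, map_neg, polyVec_mul, add_neg_cancel]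
  have E := (kernel T).equivMapOfInjective T.domain.subtype T.domain.injective_subtype
  rw [key] at E
  exact ⟨E.symm.finiteDimensional, by rw [E.finrank_eq, finrank_map_degreeLT _ hJ]⟩

theorem kernel_ne_bot_of_symbol_eq_zero (hT : HasRationalSymbol M e p qin qp T) (hp : p = 0) :
    kernel T ≠ ⊥ := by
  intro hker
  have h1 : aeval M qp e ∈ (kernel T).map T.domain.subtype :=
    mem_map_kernel_iff.2 ((hT.mem_graph_iff_exists _ _).2 ⟨e, rfl, 0, Submodule.zero_mem _, by
      simp [hp]⟩)
  rw [hker, Submodule.map_bot, Submodule.mem_bot] at h1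
  exact hT.shift.vacuum_ne_zero (hT.shift.aeval_injective hT.qp_ne_zero (h1.trans (map_zero _).symm))

theorem not_finite_cokernel (hT : HasRationalSymbol M e p qin qp T) {a : ℂ} (ha : ‖a‖ = 1)
    (hp : p.IsRoot a) : ¬ FiniteDimensional ℂ (H ⧸ range T) := fun _ =>
  hT.shift.not_finite_quotient_range_sup_polyLT ha hp qin.natDegree
    hT.cokernelEquiv.finiteDimensional

theorem finrank_cokernel (hT : HasRationalSymbol M e p qin qp T) {s t : ℂ[X]} (hp : p = s * t)
    (hs : s ≠ 0) (ht : t ≠ 0) (hs' : ∀ z, s.IsRoot z → ‖z‖ < 1) (ht' : ∀ z, t.IsRoot z → 1 < ‖z‖) :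
    FiniteDimensional ℂ (H ⧸ range T) ∧
    Module.finrank ℂ (H ⧸ range T) = s.natDegree - qin.natDegree ∧
    IsClosed (range T : Set H) := by
  have hr := range_aeval_mul_isUnit (s := s) (hT.shift.isUnit_aeval ht ht')
  rw [← hp] at hr
  obtain ⟨h1, h2⟩ := hT.shift.finrank_quotient_range_sup_polyLT hs hs' qin.natDegree
  have E := hT.cokernelEquiv
  rw [hr] at E
  refine ⟨E.symm.finiteDimensional, by rw [E.finrank_eq, h2], ?_⟩
  rw [hT.range_eq_comap, hr]
  exact (Submodule.isClosed_sup_finiteDimensional _ _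
    (hT.shift.isClosed_range_aeval hs hs')).preimage (aeval M qin).continuous

theorem isFredholm (hT : HasRationalSymbol M e p qin qp T) {s t : ℂ[X]} (hp : p = s * t)
    (hs : s ≠ 0) (ht : t ≠ 0) (hs' : ∀ z, s.IsRoot z → ‖z‖ < 1) (ht' : ∀ z, t.IsRoot z → 1 < ‖z‖) :
    IsFredholm T where
  dense_domain := hT.dense_domain
  closed := hT.isClosed
  finite_ker := (hT.finrank_kernel hp hs ht (fun z hz => (hs' z hz).le) ht').1
  finite_coker := (hT.finrank_cokernel hp hs ht hs' ht').1
  closed_range := (hT.finrank_cokernel hp hs ht hs' ht').2.2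

theorem isContinuouslyInvertible (hT : HasRationalSymbol M e p qin qp T) {s t : ℂ[X]}
    (hp : p = s * t) (hs : s ≠ 0) (ht : t ≠ 0) (hs' : ∀ z, s.IsRoot z → ‖z‖ < 1)
    (ht' : ∀ z, t.IsRoot z → 1 < ‖z‖) (hdeg : qin.natDegree ≤ s.natDegree) :
    IsContinuouslyInvertible T := by
  obtain ⟨Q, hQ, hd⟩ := hT.shift.exists_division hs hs'
  obtain ⟨v, hv⟩ := hT.shift.isUnit_aeval ht ht'
  have hv1 : ∀ h, (↑v⁻¹ : H →L[ℂ] H) (aeval M t h) = h := fun h => by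
    rw [← hv, ← mul_apply_eq_comp, Units.inv_mul, one_apply_eq_self]
  -- As deg r < deg `qin` ≤ deg s, r is its own remainder on division by s. Hence Q discards the
  -- unknown r, and the inverse is given by the bounded formula `Z`.
  have hQr : ∀ r ∈ degreeLT ℂ qin.natDegree, Q (polyVec M e r) = 0 := by
    intro r hr
    obtain ⟨r', hr', h1⟩ := hd (polyVec M e r)
    rw [← sub_eq_iff_eq_add, ← map_sub, eq_comm] at h1
    obtain ⟨x, hx, hx'⟩ := hT.shift.exists_factor_of_aeval_eq_polyVec hs (fun z hz => (hs' z hz).le) h1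
    suffices x = 0 by rw [hx', this, map_zero]
    have h2 := Submodule.sub_mem _ (degreeLT_mono hdeg hr) hr'
    by_contra h0
    rw [hx, mem_degreeLT, degree_mul, degree_eq_natDegree hs, degree_eq_natDegree h0] at h2
    norm_cast at h2
    omega
  let Z : H →L[ℂ] H := aeval M qp ∘L (↑v⁻¹ : H →L[ℂ] H) ∘L Q ∘L aeval M qin
  have hZ : ∀ u h, (u, h) ∈ T.graph → u = Z h := by
    intro u h hu
    obtain ⟨w, rfl, r, hr, h1⟩ := (hT.mem_graph_iff_exists u h).1 hu
    change _ = aeval M qp ((↑v⁻¹ : H →L[ℂ] H) (Q (aeval M qin h)))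
    rw [h1, map_add, hQr r hr, add_zero, hp, aeval_mul_apply, hQ, hv1]
  have hker : kernel T = ⊥ := by
    rw [LinearMap.ker_eq_bot']
    intro u hu
    have := hZ u _ (LinearPMap.mem_graph T u)
    rw [show T u = 0 from hu, map_zero] at this
    exact Subtype.ext this
  refine ⟨hker, ?_⟩
  have : (fun y : T.inverse.domain => T.inverse y) =
      fun y : T.inverse.domain => Z y := by
    funext y
    obtain ⟨u, hu⟩ : (y : H) ∈ range T := LinearPMap.inverse_domain.le y.2
    rw [LinearPMap.inverse_apply_eq hker (x := u) hu]
    exact hZ _ _ (LinearPMap.mem_graph_iff T |>.2 ⟨u, rfl, hu⟩)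
  rw [this]
  fun_prop

/-- The pairs (`qin` `qp` v, p v) lie in the graph (r = 0), so a bounded inverse bounds `qin` `qp` v
by p v. A Bézout relation between X - a and `qin` `qp` then bounds v by (M - a)v, making ran(M - a)
closed. -/
theorem not_isContinuouslyInvertible (hT : HasRationalSymbol M e p qin qp T) {a : ℂ} (ha : ‖a‖ = 1)
    (hp : p.IsRoot a) : ¬ IsContinuouslyInvertible T := by
  rintro ⟨hker, hcont⟩
  let I : T.inverse.domain →L[ℂ] H := ⟨T.inverse.toFun, hcont⟩
  have hI : ∀ v, ‖aeval M (qin * qp) v‖ ≤ ‖I‖ * ‖aeval M p v‖ := by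
    intro v
    have hg : (aeval M (qin * qp) v, aeval M p v) ∈ T.graph :=
      (hT.mem_graph_iff _ _).2 ⟨0, Submodule.zero_mem _, by
        rw [map_zero, map_zero, add_zero, aeval_comm_apply]⟩
    obtain ⟨u, hu, hu'⟩ := (LinearPMap.mem_graph_iff T).1 hg
    have hmem : aeval M p v ∈ T.inverse.domain := by
      rw [LinearPMap.inverse_domain]; exact ⟨u, hu'⟩
    have h1 : I ⟨_, hmem⟩ = aeval M (qin * qp) v :=
      (LinearPMap.inverse_apply_eq hker (y := ⟨_, hmem⟩) (x := u) hu').trans hu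
    rw [← h1]
    exact I.le_opNorm _
  obtain ⟨t, rfl⟩ := dvd_iff_isRoot.2 hp
  obtain ⟨x, y, hxy⟩ := hT.coprime.of_mul_left_left
  have hbd : ∀ v, ‖v‖ ≤ (‖aeval M x‖ + ‖aeval M y‖ * (‖I‖ * ‖aeval M t‖)) *
      ‖aeval M (X - C a) v‖ := by
    intro v
    have h1 : v = aeval M x (aeval M (X - C a) v) + aeval M y (aeval M (qin * qp) v) := by
      rw [← aeval_mul_apply, ← aeval_mul_apply, ← add_apply, ← map_add, hxy,
        map_one, one_apply_eq_self]
    calc ‖v‖ ≤ ‖aeval M x (aeval M (X - C a) v)‖ + ‖aeval M y (aeval M (qin * qp) v)‖ := by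
          conv_lhs => rw [h1]
          exact norm_add_le _ _
      _ ≤ ‖aeval M x‖ * ‖aeval M (X - C a) v‖ +
          ‖aeval M y‖ * (‖I‖ * (‖aeval M t‖ * ‖aeval M (X - C a) v‖)) := by
          refine add_le_add ((aeval M x).le_opNorm _) (((aeval M y).le_opNorm _).trans ?_)
          gcongr
          refine (hI v).trans ?_
          gcongr
          rw [mul_comm, aeval_mul_apply]
          exact (aeval M t).le_opNorm _
      _ = _ := by ring
  have hanti : AntilipschitzWith
      (‖aeval M x‖₊ + ‖aeval M y‖₊ * (‖I‖₊ * ‖aeval M t‖₊)) (aeval M (X - C a)) :=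
    (aeval M (X - C a)).antilipschitz_of_bound hbd
  exact hT.shift.not_isClosed_range_sub ha
    (hanti.isClosed_range (aeval M (X - C a)).uniformContinuous)

theorem dense_range (hT : HasRationalSymbol M e p qin qp T) {s t : ℂ[X]} (hp : p = s * t)
    (hs : s ≠ 0) (ht : t ≠ 0) (hs' : ∀ z, s.IsRoot z → ‖z‖ < 1) (ht' : ∀ z, t.IsRoot z → 1 ≤ ‖z‖)
    (hdeg : s.natDegree ≤ qin.natDegree) : Dense (range T : Set H) := by
  obtain ⟨Q, hQ, hd⟩ := hT.shift.exists_division hT.qin_ne_zero hT.norm_lt_one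
  -- As t(M) has dense range, the closure contains ran s(M); the polynomials of degree < deg s are
  -- there because deg s ≤ deg `qin`.
  have hV : Dense (((aeval M p).range ⊔ polyLT M e qin.natDegree : Submodule ℂ H) : Set H) := by
    rw [Submodule.dense_iff_topologicalClosure_eq_top, eq_top_iff,
      ← hT.shift.range_aeval_sup_polyLT hs hs']
    refine sup_le ?_ ((Submodule.map_mono (degreeLT_mono hdeg)).trans
      (le_sup_right.trans (Submodule.le_topologicalClosure _)))
    refine le_trans ?_ (Submodule.topologicalClosure_mono le_sup_left)
    rintro _ ⟨w, rfl⟩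
    have h1 := (hT.shift.denseRange_aeval ht ht').closure_range
    have h2 : w ∈ closure (Set.range (aeval M t)) := by rw [h1]; trivial
    refine map_mem_closure (aeval M s).continuous h2 ?_
    rintro _ ⟨x, rfl⟩
    exact ⟨x, by rw [hp]; exact aeval_mul_apply M s t x⟩
  have hQs : Function.Surjective Q := fun h => ⟨_, hQ h⟩
  -- The continuous surjection Q carries this dense space into the range of T, since `qin` Qx
  -- differs from x by a remainder already in the space.
  refine (hQs.denseRange.dense_image Q.continuous hV).mono ?_
  rintro _ ⟨x, hx, rfl⟩
  obtain ⟨r, hr, h1⟩ := hd x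
  rw [hT.range_eq_comap, SetLike.mem_coe, Submodule.mem_comap]
  change aeval M qin (Q x) ∈ _
  rw [eq_sub_iff_add_eq.2 h1.symm]
  exact Submodule.sub_mem _ hx (Submodule.mem_sup_right ⟨r, hr, rfl⟩)

theorem not_dense_range (hT : HasRationalSymbol M e p qin qp T) {s t : ℂ[X]} (hp : p = s * t)
    (hs : s ≠ 0) (hs' : ∀ z, s.IsRoot z → ‖z‖ < 1) (hdeg : qin.natDegree < s.natDegree) :
    ¬ Dense (range T : Set H) := by
  intro hd
  set V := (aeval M s).range ⊔ polyLT M e qin.natDegree with hV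
  have hcl : IsClosed (V : Set H) := Submodule.isClosed_sup_finiteDimensional _ _
    (hT.shift.isClosed_range_aeval hs hs')
  have hle : range T ≤ V.comap (aeval M qin).toLinearMap := by
    rw [hT.range_eq_comap]
    refine Submodule.comap_mono (sup_le_sup_right ?_ _)
    rintro _ ⟨w, rfl⟩
    exact ⟨aeval M t w, by rw [hp]; exact (aeval_mul_apply M s t w).symm⟩
  have htop : ∀ h, aeval M qin h ∈ V := by
    intro h
    have h1 : closure (range T : Set H) ⊆ V.comap (aeval M qin).toLinearMap :=
      closure_minimal hle (hcl.preimage (aeval M qin).continuous)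
    exact h1 (hd h)
  -- A dense range would force the closed space `V` to contain ran `qin`(M), hence everything,
  -- although its codimension is deg s - deg `qin` > 0.
  have hVtop : V = ⊤ := by
    rw [eq_top_iff, ← hT.shift.range_aeval_sup_polyLT hT.qin_ne_zero hT.norm_lt_one]
    refine sup_le ?_ le_sup_right
    rintro _ ⟨w, rfl⟩
    exact htop w
  have h2 := (hT.shift.finrank_quotient_range_sup_polyLT hs hs' qin.natDegree).2
  rw [← hV, hVtop, Module.finrank_zero_of_subsingleton] at h2
  omega

end HasRationalSymbol

end

/-! ### Multiplication by the coordinate and Fourier coefficients -/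

theorem norm_toCircle (x : UnitAddCircle) : ‖(AddCircle.toCircle x : ℂ)‖ = 1 :=
  Circle.norm_coe _

theorem memLp_toCircle_mul (f : L2T) :
    MemLp (fun x : UnitAddCircle => (AddCircle.toCircle x : ℂ) * f x) 2
      AddCircle.haarAddCircle := by
  refine (Lp.memLp f).congr_norm ?_ (Filter.Eventually.of_forall fun x => by
    rw [norm_mul, norm_toCircle, one_mul])
  exact (Continuous.aestronglyMeasurable (by fun_prop)).mul (Lp.memLp f).aestronglyMeasurable

/-- Multiplication by the coordinate `z` on `L²` of the torus. -/
def zMul : L2T →L[ℂ] L2T :=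
  LinearMap.mkContinuous
    { toFun := fun f => (memLp_toCircle_mul f).toLp _
      map_add' := fun f g => by
        rw [← MemLp.toLp_add, MemLp.toLp_eq_toLp_iff]
        filter_upwards [Lp.coeFn_add f g] with x hx
        rw [hx]
        simp [mul_add]
      map_smul' := fun c f => by
        rw [RingHom.id_apply, ← MemLp.toLp_const_smul, MemLp.toLp_eq_toLp_iff]
        filter_upwards [Lp.coeFn_smul c f] with x hx
        rw [hx]
        simp [mul_left_comm] } 1 fun f => by
    rw [one_mul]
    refine Lp.norm_le_norm_of_ae_le ?_
    filter_upwards [(memLp_toCircle_mul f).coeFn_toLp] with x hx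
    change ‖((memLp_toCircle_mul f).toLp _ : L2T) x‖ ≤ _
    rw [hx, norm_mul, norm_toCircle, one_mul]

theorem coeFn_zMul (f : L2T) :
    zMul f =ᵐ[AddCircle.haarAddCircle] fun x => (AddCircle.toCircle x : ℂ) * f x :=
  (memLp_toCircle_mul f).coeFn_toLp

theorem coeFn_aeval_zMul (p : ℂ[X]) (f : L2T) :
    aeval zMul p f =ᵐ[AddCircle.haarAddCircle]
      fun x => p.eval (AddCircle.toCircle x : ℂ) * f x := by
  induction p using Polynomial.induction_on generalizing f with
  | C a =>
    rw [aeval_C_apply]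
    filter_upwards [Lp.coeFn_smul a f] with x hx
    rw [hx]
    simp
  | add p q hp hq =>
    rw [map_add, add_apply]
    filter_upwards [Lp.coeFn_add (aeval zMul p f) (aeval zMul q f), hp f, hq f] with x hx h1 h2
    rw [hx, Pi.add_apply, h1, h2, eval_add, add_mul]
  | monomial n a ih =>
    rw [pow_succ, ← mul_assoc, aeval_mul_apply, aeval_X]
    filter_upwards [ih (zMul f), coeFn_zMul f] with x h1 h2
    rw [h1, h2, eval_mul_X, mul_assoc]

theorem zMul_fourierLp (n : ℤ) : zMul (fourierLp 2 n) = fourierLp 2 (n + 1) := by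
  refine Lp.ext ?_
  filter_upwards [coeFn_zMul (fourierLp 2 n), coeFn_fourierLp (T := 1) 2 n,
    coeFn_fourierLp (T := 1) 2 (n + 1)] with x h1 h2 h3
  rw [h1, h2, h3, fourier_add, fourier_one, mul_comm]

theorem inner_zMul_zMul (f g : L2T) : inner ℂ (zMul f) (zMul g) = inner ℂ f g := by
  rw [L2.inner_def, L2.inner_def]
  refine integral_congr_ae ?_
  filter_upwards [coeFn_zMul f, coeFn_zMul g] with x h1 h2
  rw [h1, h2, RCLike.inner_apply, RCLike.inner_apply, map_mul]
  have : (AddCircle.toCircle x : ℂ) * (starRingEnd ℂ) (AddCircle.toCircle x : ℂ) = 1 := by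
    rw [Complex.mul_conj, Circle.normSq_coe, Complex.ofReal_one]
  linear_combination (g x * (starRingEnd ℂ) (f x)) * this

/-- The `n`-th Fourier coefficient. -/
def coef (n : ℤ) (f : L2T) : ℂ := inner ℂ (fourierLp 2 n : L2T) f

theorem coef_add (n : ℤ) (f g : L2T) : coef n (f + g) = coef n f + coef n g := inner_add_right _ _ _

theorem coef_sub (n : ℤ) (f g : L2T) : coef n (f - g) = coef n f - coef n g := inner_sub_right _ _ _

theorem coef_smul (n : ℤ) (c : ℂ) (f : L2T) : coef n (c • f) = c * coef n f :=
  inner_smul_right _ _ _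

theorem coef_zMul (n : ℤ) (f : L2T) : coef n (zMul f) = coef (n - 1) f := by
  rw [coef, coef, ← inner_zMul_zMul (fourierLp 2 (n - 1)), zMul_fourierLp, sub_add_cancel]

theorem coef_fourierLp (m n : ℤ) : coef m (fourierLp 2 n) = if m = n then 1 else 0 :=
  orthonormal_iff_ite.1 (orthonormal_fourier (T := 1)) m n

theorem ext_coef {f g : L2T} (h : ∀ n, coef n f = coef n g) : f = g := by
  refine (fourierBasis (T := 1)).repr.injective (lp.ext (funext fun n => ?_))
  rw [HilbertBasis.repr_apply_apply, HilbertBasis.repr_apply_apply, coe_fourierBasis]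
  exact h n

theorem tendsto_coef (f : L2T) : Filter.Tendsto (fun n => ‖coef n f‖) Filter.cofinite (nhds 0) := by
  have h := ((orthonormal_fourier (T := 1)).inner_products_summable f).tendsto_cofinite_zero
  have h2 := h.sqrt
  simpa [coef] using h2

/-- Fourier coefficients tend to zero, so one dominated by infinitely many others vanishes. -/
theorem coef_eq_zero_of_norm_le {f : L2T} {n : ℤ} {φ : ℕ → ℤ} (hφ : Function.Injective φ)
    (h : ∀ j, ‖coef n f‖ ≤ ‖coef (φ j) f‖) : coef n f = 0 := by
  have h1 : Filter.Tendsto (fun j => ‖coef (φ j) f‖) Filter.atTop (nhds 0) := by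
    rw [← Nat.cofinite_eq_atTop]
    exact (tendsto_coef f).comp hφ.tendsto_cofinite
  exact norm_le_zero_iff.1 (ge_of_tendsto' h1 h)

theorem coef_aeval_zMul_X_sub_C (n : ℤ) (a : ℂ) (f : L2T) :
    coef n (aeval zMul (X - C a) f) = coef (n - 1) f - a * coef n f := by
  rw [aeval_X_sub_C_apply, coef_sub, coef_smul, coef_zMul]

theorem coef_aeval_zMul_eq_zero {s : ℂ[X]} (hs : s ≠ 0) {N : ℤ} {f : L2T}
    (hf : ∀ n, N ≤ n → coef n f = 0) :
    ∀ n, N + s.natDegree ≤ n → coef n (aeval zMul s f) = 0 := by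
  refine polynomial_induction_on_roots (K := fun _ => True)
    (Φ := fun s => ∀ n, N + s.natDegree ≤ n → coef n (aeval zMul s f) = 0)
    (fun c hc n hn => ?_) (fun a s _ hs ih n hn => ?_) s hs (fun _ _ => trivial)
  · rw [natDegree_C] at hn
    rw [aeval_C_apply, coef_smul, hf n (by omega), mul_zero]
  · rw [natDegree_mul (X_sub_C_ne_zero a) hs, natDegree_X_sub_C] at hn
    rw [aeval_mul_apply, coef_aeval_zMul_X_sub_C, ih n (by omega), ih (n - 1) (by omega)]
    simp

/-- For a factor z - a the hypothesis reads f_{n-1} = a f_n below N; as |a| ≥ 1, moduli do not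
decrease towards -∞. Zeros on the circle are allowed. -/
theorem coef_eq_zero_of_one_le_norm {s : ℂ[X]} (hs : s ≠ 0) (hr : ∀ z, s.IsRoot z → 1 ≤ ‖z‖)
    {N : ℤ} {f : L2T} (hf : ∀ n < N, coef n (aeval zMul s f) = 0) : ∀ n < N, coef n f = 0 := by
  revert f
  refine polynomial_induction_on_roots (K := fun z => 1 ≤ ‖z‖)
    (Φ := fun s => ∀ {f : L2T}, (∀ n < N, coef n (aeval zMul s f) = 0) → ∀ n < N, coef n f = 0)
    (fun c hc f hf n hn => ?_) (fun a s ha hs ih f hf => ih fun n hn => ?_) s hs hr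
  · have := hf n hn
    rw [aeval_C_apply, coef_smul] at this
    exact (mul_eq_zero.1 this).resolve_left hc
  · refine coef_eq_zero_of_norm_le (φ := fun j : ℕ => n - j) (fun i j hij => by simpa using hij)
      fun j => ?_
    induction j with
    | zero => simp
    | succ j ih =>
      refine ih.trans ?_
      have h1 := hf (n - j) (by omega)
      rw [aeval_mul_apply, coef_aeval_zMul_X_sub_C, sub_eq_zero] at h1
      push_cast
      rw [← sub_sub, h1, norm_mul]
      exact le_mul_of_one_le_left (norm_nonneg _) ha

/-- The mirror argument towards +∞: f_n = a f_{n+1} with |a| < 1. -/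
theorem coef_eq_zero_of_norm_lt_one {s : ℂ[X]} (hs : s ≠ 0) (hr : ∀ z, s.IsRoot z → ‖z‖ < 1)
    {N : ℤ} {f : L2T} (hf : ∀ n, N + s.natDegree ≤ n → coef n (aeval zMul s f) = 0) :
    ∀ n, N ≤ n → coef n f = 0 := by
  revert f
  refine polynomial_induction_on_roots (K := fun z => ‖z‖ < 1)
    (Φ := fun s => ∀ {f : L2T}, (∀ n, N + s.natDegree ≤ n → coef n (aeval zMul s f) = 0) →
      ∀ n, N ≤ n → coef n f = 0)
    (fun c hc f hf n hn => ?_) (fun a s ha hs ih f hf => ih fun n hn => ?_) s hs hr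
  · have := hf n (by rw [natDegree_C]; omega)
    rw [aeval_C_apply, coef_smul] at this
    exact (mul_eq_zero.1 this).resolve_left hc
  · rw [natDegree_mul (X_sub_C_ne_zero a) hs, natDegree_X_sub_C] at hf
    refine coef_eq_zero_of_norm_le (φ := fun j : ℕ => n + j) (fun i j hij => by simpa using hij)
      fun j => ?_
    induction j with
    | zero => simp
    | succ j ih =>
      refine ih.trans ?_
      have h1 := hf (n + j + 1) (by push_cast; omega)
      rw [aeval_mul_apply, coef_aeval_zMul_X_sub_C, sub_eq_zero, add_sub_cancel_right] at h1
      push_cast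
      rw [← add_assoc, h1, norm_mul]
      exact mul_le_of_le_one_left (norm_nonneg _) ha.le

/-! ### The shift on the Hardy space -/

theorem mem_orthogonal_hardySpace_iff {f : L2T} :
    f ∈ hardySpaceᗮ ↔ ∀ n : ℤ, 0 ≤ n → coef n f = 0 := by
  rw [hardySpace, Submodule.orthogonal_closure]
  constructor
  · intro h n hn
    lift n to ℕ using hn
    exact (Submodule.mem_orthogonal _ _).1 h _ (Submodule.subset_span ⟨n, rfl⟩)
  · intro h
    refine (Submodule.mem_orthogonal _ _).2 fun u hu => ?_
    induction hu using Submodule.span_induction with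
    | mem x hx => obtain ⟨n, rfl⟩ := hx; exact h n (Int.natCast_nonneg n)
    | zero => exact inner_zero_left _
    | add x y _ _ hx hy => rw [inner_add_left, hx, hy, add_zero]
    | smul c x _ hx => rw [inner_smul_left, hx, mul_zero]

theorem mem_hardySpace_iff {f : L2T} : f ∈ hardySpace ↔ ∀ n < 0, coef n f = 0 := by
  constructor
  · intro h n hn
    have h1 : (fourierLp 2 n : L2T) ∈ hardySpaceᗮ := mem_orthogonal_hardySpace_iff.2 fun m hm => by
      rw [coef_fourierLp, if_neg (by omega)]
    exact (Submodule.mem_orthogonal' _ _).1 h1 _ h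
  · intro h
    rw [← Submodule.orthogonal_orthogonal hardySpace, Submodule.mem_orthogonal]
    intro v hv
    rw [mem_orthogonal_hardySpace_iff] at hv
    -- In Parseval's formula each term has a vanishing factor: f has no negative coefficients, v no
    -- others.
    rw [← (fourierBasis (T := 1)).tsum_inner_mul_inner v f]
    convert tsum_zero with n
    rw [coe_fourierBasis]
    rcases lt_or_ge n 0 with hn | hn
    · rw [show inner ℂ (fourierLp 2 n : L2T) f = 0 from h n hn, mul_zero]
    · rw [← inner_conj_symm, show inner ℂ (fourierLp 2 n : L2T) v = 0 from hv n hn, map_zero,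
        zero_mul]

theorem fourierLp_mem_hardySpace {n : ℤ} (hn : 0 ≤ n) : (fourierLp 2 n : L2T) ∈ hardySpace :=
  mem_hardySpace_iff.2 fun m hm => by rw [coef_fourierLp, if_neg (by omega)]

theorem zMul_mem_hardySpace {f : L2T} (hf : f ∈ hardySpace) : zMul f ∈ hardySpace :=
  mem_hardySpace_iff.2 fun n hn => by
    rw [coef_zMul]
    exact mem_hardySpace_iff.1 hf _ (by omega)

/-- Multiplication by `z` on the Hardy space. -/
def hardyShift : hardySpace →L[ℂ] hardySpace :=
  (zMul ∘L hardySpace.subtypeL).codRestrict hardySpace fun u => zMul_mem_hardySpace u.2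

/-- The constant function `1` in the Hardy space. -/
def hardyOne : hardySpace := ⟨fourierLp 2 0, fourierLp_mem_hardySpace le_rfl⟩

theorem coe_hardyShift (u : hardySpace) : (hardyShift u : L2T) = zMul u := rfl

theorem coe_aeval_hardyShift (p : ℂ[X]) (u : hardySpace) :
    (aeval hardyShift p u : L2T) = aeval zMul p (u : L2T) := by
  induction p using Polynomial.induction_on generalizing u with
  | C a => rw [aeval_C_apply, aeval_C_apply]; rfl
  | add p q hp hq =>
    rw [map_add, map_add, add_apply, add_apply, Submodule.coe_add, hp, hq]
  | monomial n a ih =>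
    rw [pow_succ, ← mul_assoc, aeval_mul_apply _ _ X, aeval_mul_apply _ _ X, aeval_X, aeval_X, ih,
      coe_hardyShift]

theorem coef_adjoint_hardyShift (v : hardySpace) {n : ℤ} (hn : 0 ≤ n) :
    coef n (ContinuousLinearMap.adjoint hardyShift v : hardySpace) = coef (n + 1) v := by
  have h := ContinuousLinearMap.adjoint_inner_right hardyShift
    (⟨fourierLp 2 n, fourierLp_mem_hardySpace hn⟩ : hardySpace) v
  rw [Submodule.coe_inner, Submodule.coe_inner, coe_hardyShift, zMul_fourierLp] at h
  exact h

theorem hardySpace_ext {u v : hardySpace} (h : ∀ n, 0 ≤ n → coef n u = coef n v) : u = v := by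
  refine Subtype.ext (ext_coef fun n => ?_)
  rcases lt_or_ge n 0 with hn | hn
  · rw [mem_hardySpace_iff.1 u.2 n hn, mem_hardySpace_iff.1 v.2 n hn]
  · exact h n hn

theorem isUnilateralShift_hardyShift : IsUnilateralShift hardyShift hardyOne where
  adjoint_apply_self h := hardySpace_ext fun n hn => by
    rw [coef_adjoint_hardyShift _ hn, coe_hardyShift, coef_zMul, add_sub_cancel_right]
  adjoint_vacuum := hardySpace_ext fun n hn => by
    rw [coef_adjoint_hardyShift _ hn, hardyOne, coef_fourierLp, if_neg (by omega)]
    exact (inner_zero_right _).symm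
  eq_smul_vacuum h hh := ⟨coef 0 h, hardySpace_ext fun n hn => by
    rw [Submodule.coe_smul, coef_smul, hardyOne, coef_fourierLp]
    split_ifs with h0
    · rw [h0, mul_one]
    · have := coef_adjoint_hardyShift h (n := n - 1) (by omega)
      rw [hh, sub_add_cancel] at this
      rw [← this, mul_zero]
      exact inner_zero_right _⟩
  vacuum_ne_zero h := by
    have h1 := coef_fourierLp 0 0
    rw [show (fourierLp 2 0 : L2T) = 0 from congrArg Subtype.val h, if_pos rfl] at h1
    exact zero_ne_one ((inner_zero_right _).symm.trans h1)
  eq_zero_of_adjoint_eq μ v hμ hv := hardySpace_ext fun n hn => by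
    rw [show coef n ((0 : hardySpace) : L2T) = 0 from inner_zero_right _]
    refine coef_eq_zero_of_norm_le (φ := fun j : ℕ => n + j) (fun i j hij => by simpa using hij)
      fun j => ?_
    induction j with
    | zero => simp
    | succ j ih =>
      -- M* is the backward shift, so v_{n+1} = μ v_n and the moduli do not decrease.
      refine ih.trans ?_
      have h1 := coef_adjoint_hardyShift v (n := n + j) (by omega)
      rw [hv, Submodule.coe_smul, coef_smul] at h1
      push_cast
      rw [← add_assoc, ← h1, norm_mul]
      exact le_mul_of_one_le_left (norm_nonneg _) hμ

theorem coe_polyVec_hardyOne (r : ℂ[X]) :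
    (polyVec hardyShift hardyOne r : L2T) = aeval zMul r (fourierLp 2 0 : L2T) :=
  coe_aeval_hardyShift r hardyOne

theorem coef_polyVec_hardyOne (r : ℂ[X]) (n : ℕ) :
    coef n (polyVec hardyShift hardyOne r) = r.coeff n := by
  have hpow : ∀ k : ℕ, aeval zMul (X ^ k : ℂ[X]) (fourierLp 2 0 : L2T) = fourierLp 2 (k : ℤ) := by
    intro k
    induction k with
    | zero => simp
    | succ k ih =>
      rw [pow_succ', aeval_mul_apply, ih, aeval_X, zMul_fourierLp]
      push_cast
      rfl
  rw [coe_polyVec_hardyOne]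
  induction r using Polynomial.induction_on' with
  | add p q hp hq => rw [map_add, add_apply, coef_add, hp, hq, coeff_add]
  | monomial k a =>
    rw [← C_mul_X_pow_eq_monomial, aeval_mul_apply, hpow, aeval_C_apply, coef_smul, coef_fourierLp,
      coeff_C_mul_X_pow]
    norm_cast
    split_ifs <;> simp

theorem exists_polyVec_eq {f : L2T} {N : ℕ} (h1 : ∀ n < 0, coef n f = 0)
    (h2 : ∀ n : ℤ, N ≤ n → coef n f = 0) :
    ∃ r ∈ degreeLT ℂ N, f = polyVec hardyShift hardyOne r := by
  refine ⟨∑ k ∈ Finset.range N, C (coef k f) * X ^ k, Submodule.sum_mem _ fun k hk => ?_,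
    ext_coef fun n => ?_⟩
  · rw [mem_degreeLT]
    refine (degree_C_mul_X_pow_le _ _).trans_lt ?_
    exact_mod_cast Finset.mem_range.1 hk
  · rcases lt_or_ge n 0 with hn | hn
    · rw [h1 n hn, mem_hardySpace_iff.1 (Subtype.mem _) n hn]
    · lift n to ℕ using hn
      rw [coef_polyVec_hardyOne, finsetSum_coeff]
      simp only [coeff_C_mul_X_pow, Finset.sum_ite_eq, Finset.mem_range]
      split_ifs with hN
      · rfl
      · exact h2 n (by omega)

/-! ### The graph of a Toeplitz operator with rational symbol -/

theorem mem_graph_toeplitz_iff {ω : UnitAddCircle → ℂ} {u h : hardySpace} :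
    (u, h) ∈ (toeplitz ω).graph ↔ ∃ f : L2T,
      f =ᵐ[AddCircle.haarAddCircle] (fun x => ω x * (u : L2T) x) ∧
        hardySpace.orthogonalProjectionOnto f = h := by
  rw [LinearPMap.mem_graph_iff]
  constructor
  · rintro ⟨v, rfl, hv⟩
    exact ⟨_, (mem_toeplitzDomain.1 v.2).coeFn_toLp, hv⟩
  · rintro ⟨f, hf, hh⟩
    have hu : u ∈ toeplitzDomain ω := mem_toeplitzDomain.2 ((Lp.memLp f).ae_eq hf)
    refine ⟨⟨u, hu⟩, rfl, ?_⟩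
    rw [← hh]
    refine congrArg hardySpace.orthogonalProjectionOnto (Lp.ext ?_)
    exact (mem_toeplitzDomain.1 hu).coeFn_toLp.trans hf.symm

theorem ae_eval_toCircle_ne_zero {S : ℂ[X]} (hS : S ≠ 0) :
    ∀ᵐ x : UnitAddCircle ∂AddCircle.haarAddCircle, S.eval (AddCircle.toCircle x : ℂ) ≠ 0 := by
  have : {x : UnitAddCircle | S.eval (AddCircle.toCircle x : ℂ) = 0}.Finite := by
    refine Set.Finite.subset ((S.roots.toFinset.finite_toSet).preimage
      (f := fun x : UnitAddCircle => (AddCircle.toCircle x : ℂ)) ?_) fun x hx => ?_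
    · exact (Subtype.val_injective.comp (AddCircle.injective_toCircle one_ne_zero)).injOn
    · simpa [hS] using hx
  have h0 : ∀ x : UnitAddCircle, AddCircle.haarAddCircle {x} = 0 := fun x => by
    have h := AddCircle.volume_closedBall 1 (x := x) 0
    rw [AddCircle.volume_eq_smul_haarAddCircle, Metric.closedBall_zero] at h
    simpa using h
  rw [ae_iff]
  simp only [not_not]
  rw [← Set.biUnion_of_singleton {x : UnitAddCircle | S.eval (AddCircle.toCircle x : ℂ) = 0}]
  exact (measure_biUnion_null_iff this.countable).2 fun x _ => h0 x

theorem ae_eq_rationalSymbol_mul_iff (R : ℂ[X]) {S : ℂ[X]} (hS : S ≠ 0) (u f : L2T) :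
    f =ᵐ[AddCircle.haarAddCircle] (fun x => rationalSymbol R S x * u x) ↔
      aeval zMul S f = aeval zMul R u := by
  constructor
  · intro h
    refine Lp.ext ?_
    filter_upwards [h, coeFn_aeval_zMul S f, coeFn_aeval_zMul R u, ae_eval_toCircle_ne_zero hS]
      with x h1 h2 h3 h4
    rw [h2, h3, h1, rationalSymbol, ← mul_assoc, mul_div_cancel₀ _ h4]
  · intro h
    have h' := coeFn_aeval_zMul S f
    rw [h] at h'
    filter_upwards [h', coeFn_aeval_zMul R u, ae_eval_toCircle_ne_zero hS] with x h2 h3 h4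
    rw [rationalSymbol, div_mul_eq_mul_div, ← h3, h2, mul_div_cancel_left₀ _ h4]

/-- The quotient r/s is continuous on the circle, where s has no zeros. -/
theorem exists_aeval_zMul_eq {s : ℂ[X]} (hr : ∀ z, s.IsRoot z → ‖z‖ < 1) (r : ℂ[X]) :
    ∃ g : L2T, aeval zMul s g = polyVec hardyShift hardyOne r := by
  have hs : ∀ x : UnitAddCircle, s.eval (AddCircle.toCircle x : ℂ) ≠ 0 := fun x hx => by
    have := hr _ hx
    rw [norm_toCircle] at this
    exact this.false
  let φ : C(UnitAddCircle, ℂ) :=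
    ⟨fun x => r.eval (AddCircle.toCircle x : ℂ) / s.eval (AddCircle.toCircle x : ℂ), by
      refine Continuous.div ?_ ?_ hs
      · exact r.continuous.comp (by fun_prop)
      · exact s.continuous.comp (by fun_prop)⟩
  refine ⟨ContinuousMap.toLp 2 AddCircle.haarAddCircle ℂ φ, ?_⟩
  rw [coe_polyVec_hardyOne]
  refine Lp.ext ?_
  filter_upwards [coeFn_aeval_zMul s (ContinuousMap.toLp 2 AddCircle.haarAddCircle ℂ φ),
    coeFn_aeval_zMul r (fourierLp 2 0 : L2T), coeFn_fourierLp (T := 1) 2 0,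
    ContinuousMap.coeFn_toLp (p := 2) (𝕜 := ℂ) AddCircle.haarAddCircle φ] with x h1 h2 h3 h4
  rw [h1, h2, h3, h4, fourier_zero, mul_one]
  exact mul_div_cancel₀ _ (hs x)

theorem mem_graph_toeplitz_rationalSymbol_iff (R : ℂ[X]) {qin qp : ℂ[X]} (hqin : qin ≠ 0)
    (hqp : qp ≠ 0) (hin : ∀ z, qin.IsRoot z → ‖z‖ < 1) (hp : ∀ z, qp.IsRoot z → 1 ≤ ‖z‖)
    (u h : hardySpace) :
    (u, h) ∈ (toeplitz (rationalSymbol R (qin * qp))).graph ↔ ∃ r ∈ degreeLT ℂ qin.natDegree,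
      aeval hardyShift (qin * qp) h = aeval hardyShift R u +
        aeval hardyShift qp (polyVec hardyShift hardyOne r) := by
  have hq : qin * qp ≠ 0 := mul_ne_zero hqin hqp
  rw [mem_graph_toeplitz_iff]
  simp only [ae_eq_rationalSymbol_mul_iff R hq]
  constructor
  · rintro ⟨f, hf, rfl⟩
    set h := hardySpace.orthogonalProjectionOnto f
    have hg : f - (h : L2T) ∈ hardySpaceᗮ := hardySpace.sub_starProjection_mem_orthogonal f
    have h1 := coef_aeval_zMul_eq_zero hqin (mem_orthogonal_hardySpace_iff.1 hg)
    rw [zero_add] at h1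
    have h2 : aeval zMul qp (aeval zMul qin (f - (h : L2T))) =
        (aeval hardyShift R u - aeval hardyShift (qin * qp) h : hardySpace) := by
      rw [← aeval_mul_apply, mul_comm, map_sub, hf, Submodule.coe_sub, coe_aeval_hardyShift,
        coe_aeval_hardyShift]
    -- With g = f - h, `qin` g has no coefficients of index ≥ deg `qin`. It has none of negative
    -- index, because `qp` `qin` g = R u - S h lies in H². So it is a polynomial.
    obtain ⟨r, hr, h3⟩ := exists_polyVec_eq (coef_eq_zero_of_one_le_norm hqp hp fun n hn => by
      rw [h2]; exact mem_hardySpace_iff.1 (Subtype.mem _) n hn) h1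
    refine ⟨-r, Submodule.neg_mem _ hr, ?_⟩
    rw [h3, ← coe_aeval_hardyShift] at h2
    rw [map_neg, map_neg, Subtype.ext h2]
    abel
  · rintro ⟨r, hr, h1⟩
    obtain ⟨g, hg⟩ := exists_aeval_zMul_eq hin r
    -- Conversely g = r/`qin` with deg r < deg `qin` has only negative coefficients, so h is the
    -- projection of h + g.
    have hg' : g ∈ hardySpaceᗮ := by
      refine mem_orthogonal_hardySpace_iff.2 (coef_eq_zero_of_norm_lt_one hqin hin fun n hn => ?_)
      rw [zero_add] at hn
      lift n to ℕ using (by omega)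
      rw [hg, coef_polyVec_hardyOne]
      rw [mem_degreeLT] at hr
      exact coeff_eq_zero_of_degree_lt (hr.trans_le (by exact_mod_cast hn))
    refine ⟨h - g, ?_, ?_⟩
    · have h2 := congrArg (Subtype.val : hardySpace → L2T) h1
      rw [Submodule.coe_add, coe_aeval_hardyShift, coe_aeval_hardyShift, coe_aeval_hardyShift] at h2
      rw [map_sub, h2, mul_comm qin, aeval_mul_apply, hg, add_sub_cancel_right]
    · rw [map_sub, hardySpace.orthogonalProjectionOnto_mem_subspace_eq_self,
        hardySpace.orthogonalProjectionOnto_eq_zero_iff.2 hg', sub_zero]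

theorem mem_graph_subScalar_iff {H : Type*} [NormedAddCommGroup H] [InnerProductSpace ℂ H]
    (T : H →ₗ.[ℂ] H) (z : ℂ) (u h : H) :
    (u, h) ∈ (subScalar T z).graph ↔ (u, h + z • u) ∈ T.graph := by
  rw [LinearPMap.mem_graph_iff, LinearPMap.mem_graph_iff]
  constructor
  · rintro ⟨v, rfl, hv⟩
    exact ⟨v, rfl, sub_eq_iff_eq_add.1 hv⟩
  · rintro ⟨v, rfl, hv⟩
    exact ⟨v, rfl, sub_eq_iff_eq_add.2 hv⟩

theorem hasRationalSymbol_subScalar_toeplitz {R qin qp : ℂ[X]} (hR : IsCoprime R (qin * qp))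
    (hqin : qin ≠ 0) (hqp : qp ≠ 0) (hin : ∀ z, qin.IsRoot z → ‖z‖ < 1)
    (hp : ∀ z, qp.IsRoot z → 1 ≤ ‖z‖) (z : ℂ) :
    HasRationalSymbol hardyShift hardyOne (R - C z * (qin * qp)) qin qp
      (subScalar (toeplitz (rationalSymbol R (qin * qp))) z) where
  shift := isUnilateralShift_hardyShift
  coprime := by
    have := hR.add_mul_right_left (-C z)
    rwa [neg_mul, ← sub_eq_add_neg] at this
  qin_ne_zero := hqin
  qp_ne_zero := hqp
  norm_lt_one := hin
  one_le_norm := hp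
  mem_graph_iff u h := by
    rw [mem_graph_subScalar_iff, mem_graph_toeplitz_rationalSymbol_iff R hqin hqp hin hp]
    refine exists_congr fun r => and_congr_right fun _ => ?_
    rw [map_add, map_smul, map_sub, sub_apply, aeval_mul_apply _ (C z), aeval_C_apply,
      ← eq_sub_iff_add_eq, sub_add_eq_add_sub]


/-! ### Factorization of polynomials according to the modulus of the zeros -/

theorem prod_X_sub_C_ne_zero (m : Multiset ℂ) : (m.map fun b => X - C b).prod ≠ 0 :=
  (monic_multiset_prod_of_monic _ _ fun b _ => monic_X_sub_C b).ne_zero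

theorem mem_of_isRoot_prod_X_sub_C {m : Multiset ℂ} {z : ℂ}
    (hz : ((m.map fun b => X - C b).prod).IsRoot z) : z ∈ m := by
  rwa [← mem_roots (prod_X_sub_C_ne_zero m), roots_multiset_prod_X_sub_C] at hz

theorem inFactor_ne_zero {p : ℂ[X]} (hp : p ≠ 0) : inFactor p ≠ 0 := by
  rw [inFactor, if_neg hp]
  exact prod_X_sub_C_ne_zero _

theorem circleFactor_ne_zero {p : ℂ[X]} (hp : p ≠ 0) : circleFactor p ≠ 0 := by
  rw [circleFactor, if_neg hp]
  exact prod_X_sub_C_ne_zero _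

theorem norm_lt_one_of_isRoot_inFactor {p : ℂ[X]} (hp : p ≠ 0) {z : ℂ}
    (hz : (inFactor p).IsRoot z) : ‖z‖ < 1 := by
  rw [inFactor, if_neg hp] at hz
  exact (Multiset.mem_filter.1 (mem_of_isRoot_prod_X_sub_C hz)).2

theorem norm_eq_one_of_isRoot_circleFactor {p : ℂ[X]} (hp : p ≠ 0) {z : ℂ}
    (hz : (circleFactor p).IsRoot z) : ‖z‖ = 1 := by
  rw [circleFactor, if_neg hp] at hz
  exact (Multiset.mem_filter.1 (mem_of_isRoot_prod_X_sub_C hz)).2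

open Classical in
theorem exists_eq_inFactor_mul {p : ℂ[X]} (hp : p ≠ 0) :
    ∃ t : ℂ[X], t ≠ 0 ∧ (∀ z, t.IsRoot z → 1 < ‖z‖) ∧
      p = inFactor p * (circleFactor p * t) := by
  refine ⟨C p.leadingCoeff * ((p.roots.filter fun b => 1 < ‖b‖).map fun b => X - C b).prod,
    mul_ne_zero (C_ne_zero.2 (leadingCoeff_ne_zero.2 hp)) (prod_X_sub_C_ne_zero _), fun z hz => ?_,
    ?_⟩
  · rw [IsRoot, eval_mul, eval_C, mul_eq_zero, or_iff_right (leadingCoeff_ne_zero.2 hp)] at hz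
    exact (Multiset.mem_filter.1 (mem_of_isRoot_prod_X_sub_C hz)).2
  · have h1 : p.roots = (p.roots.filter fun b => ‖b‖ < 1) + ((p.roots.filter fun b => ‖b‖ = 1) +
        p.roots.filter fun b => 1 < ‖b‖) := by
      ext b
      simp only [Multiset.count_add, Multiset.count_filter]
      rcases lt_trichotomy ‖b‖ 1 with h | h | h
      · simp [h, h.ne, h.le]
      · simp [h]
      · simp [h, h.ne', h.le]
    conv_lhs => rw [(IsAlgClosed.splits p).eq_prod_roots, h1]
    rw [inFactor, circleFactor, if_neg hp, if_neg hp, Multiset.map_add, Multiset.map_add,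
      Multiset.prod_add, Multiset.prod_add]
    ring

/-- A zero of R - zS cannot be a pole, since it would then be a common zero of R and S. -/
theorem mem_symbolValues_iff {R S : ℂ[X]} (hRS : ∀ z : ℂ, ¬ (R.IsRoot z ∧ S.IsRoot z)) (z : ℂ) :
    z ∈ symbolValues R S ↔ ∃ a : ℂ, ‖a‖ = 1 ∧ (R - C z * S).IsRoot a := by
  constructor
  · rintro ⟨x, hx, rfl⟩
    refine ⟨_, norm_toCircle x, ?_⟩
    rw [IsRoot, eval_sub, eval_mul, eval_C, rationalSymbol, div_mul_cancel₀ _ hx, sub_self]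
  · rintro ⟨a, ha, h⟩
    obtain ⟨x, hx⟩ := (AddCircle.homeomorphCircle (one_ne_zero (α := ℝ))).surjective
      (⟨a, mem_sphere_zero_iff_norm.2 ha⟩ : Circle)
    have hxa : (AddCircle.toCircle x : ℂ) = a := by
      rw [AddCircle.homeomorphCircle_apply] at hx
      exact congrArg Subtype.val hx
    rw [IsRoot, eval_sub, eval_mul, eval_C, sub_eq_zero] at h
    have hS : S.eval a ≠ 0 := fun h0 => hRS a ⟨by rw [IsRoot, h, h0, mul_zero], h0⟩
    refine ⟨x, ?_, ?_⟩
    · rwa [Set.mem_ofPred_eq, hxa]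
    · rw [rationalSymbol, hxa, h, mul_div_cancel_right₀ _ hS]

theorem mem_pointSpectrum_iff {H : Type*} [NormedAddCommGroup H] [InnerProductSpace ℂ H]
    (T : H →ₗ.[ℂ] H) (z : ℂ) : z ∈ pointSpectrum T ↔ kernel (subScalar T z) ≠ ⊥ := by
  rw [Submodule.ne_bot_iff]
  constructor
  · rintro ⟨u, hu, h⟩
    exact ⟨u, sub_eq_zero.2 h, hu⟩
  · rintro ⟨u, h, hu⟩
    exact ⟨u, hu, sub_eq_zero.1 h⟩

end RationalToeplitz

end

/-! ### The classification of spectral points -/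

theorem mainTheorem2 (R S : Polynomial ℂ) (hR : R ≠ 0) (hS : S ≠ 0)
    (hRS : ∀ z : ℂ, ¬ (R.IsRoot z ∧ S.IsRoot z)) (lam : ℂ) :
    let T := RationalToeplitz.toeplitz (RationalToeplitz.rationalSymbol R S)
    let Tl := RationalToeplitz.subScalar T lam
    let Rl := R - Polynomial.C lam * S
    let values := RationalToeplitz.symbolValues R S
    let Sin := RationalToeplitz.inFactor S
    let Rin := RationalToeplitz.inFactor Rl
    let Rinbar := RationalToeplitz.closedInFactor Rl
    (lam ∈ RationalToeplitz.fredholmPoints T ↔ lam ∉ values) ∧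
    (lam ∈ RationalToeplitz.fredholmPoints T →
      (Module.finrank ℂ (RationalToeplitz.kernel Tl) : ℤ)
          = max 0 ((Sin.natDegree : ℤ) - (Rin.natDegree : ℤ)) ∧
      FiniteDimensional ℂ (RationalToeplitz.range Tl)ᗮ ∧
      (Module.finrank ℂ (RationalToeplitz.range Tl)ᗮ : ℤ)
          = max 0 ((Rin.natDegree : ℤ) - (Sin.natDegree : ℤ)) ∧
      RationalToeplitz.index Tl = (Sin.natDegree : ℤ) - (Rin.natDegree : ℤ)) ∧
    (lam ∈ RationalToeplitz.regularValues T ↔ lam ∉ values ∧ Sin.degree ≤ Rin.degree) ∧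
    (lam ∈ RationalToeplitz.resolventPoints T ↔ lam ∉ values ∧ Sin.degree = Rin.degree) ∧
    (lam ∈ RationalToeplitz.spectralValues T ↔ lam ∈ values ∨ Sin.degree ≠ Rin.degree) ∧
    (lam ∈ RationalToeplitz.pointSpectrum T ↔ Rinbar.degree < Sin.degree) ∧
    (lam ∈ RationalToeplitz.continuousSpectrum T ↔
      lam ∈ values ∧ Rin.degree ≤ Sin.degree ∧ Sin.degree ≤ Rinbar.degree) ∧
    (lam ∈ RationalToeplitz.residualSpectrum T ↔ Sin.degree < Rin.degree) := by
  open RationalToeplitz in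
  intro T Tl Rl values Sin Rin Rinbar
  obtain ⟨tS, htS, htS', hSeq⟩ := exists_eq_inFactor_mul hS
  have hSin : Sin ≠ 0 := inFactor_ne_zero hS
  have hT : HasRationalSymbol hardyShift hardyOne Rl Sin (circleFactor S * tS) Tl := by
    have hcop : IsCoprime R S :=
      (Polynomial.isCoprime_iff_aeval_ne_zero_of_isAlgClosed ℂ ℂ R S).2 fun z => by
        by_contra! h
        simp only [Polynomial.coe_aeval_eq_eval] at h
        exact hRS z h
    have key := hasRationalSymbol_subScalar_toeplitz (R := R) (qin := Sin)
      (qp := circleFactor S * tS) (by rwa [← hSeq]) hSin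
      (mul_ne_zero (circleFactor_ne_zero hS) htS) (fun z hz => norm_lt_one_of_isRoot_inFactor hS hz)
      (fun z hz => by
        rw [Polynomial.IsRoot, Polynomial.eval_mul, mul_eq_zero] at hz
        rcases hz with hz | hz
        · exact (norm_eq_one_of_isRoot_circleFactor hS hz).ge
        · exact (htS' z hz).le) lam
    rwa [← hSeq] at key
  have hval : lam ∈ values ↔ ∃ a : ℂ, ‖a‖ = 1 ∧ Rl.IsRoot a := mem_symbolValues_iff hRS lam
  have hinv : lam ∈ regularValues T ↔ IsContinuouslyInvertible Tl := Iff.rfl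
  have hSd : Sin.degree = (Sin.natDegree : WithBot ℕ) := Polynomial.degree_eq_natDegree hSin
  rw [mem_pointSpectrum_iff]
  change (IsFredholm Tl ↔ _) ∧ (IsFredholm Tl → _) ∧ (IsContinuouslyInvertible Tl ↔ _) ∧
    (IsContinuouslyInvertible Tl ∧ range Tl = ⊤ ↔ _) ∧
    (¬ (IsContinuouslyInvertible Tl ∧ range Tl = ⊤) ↔ _) ∧ (kernel Tl ≠ ⊥ ↔ _) ∧
    (kernel Tl = ⊥ ∧ Dense (range Tl : Set hardySpace) ∧ ¬ IsClosed (range Tl : Set hardySpace) ↔ _) ∧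
    (kernel Tl = ⊥ ∧ ¬ Dense (range Tl : Set hardySpace) ↔ _)
  have hv1 : lam ∈ values → ¬ FiniteDimensional ℂ (hardySpace ⧸ range Tl) := fun h => by
    obtain ⟨a, ha, ha'⟩ := hval.1 h
    exact hT.not_finite_cokernel ha ha'
  have hv2 : lam ∈ values → ¬ IsContinuouslyInvertible Tl := fun h => by
    obtain ⟨a, ha, ha'⟩ := hval.1 h
    exact hT.not_isContinuouslyInvertible ha ha'
  -- If R = λS the symbol is the constant λ: every circle point gives the value λ, the kernel is
  -- nonzero, and the degrees of `Rin` and `Rinbar` are ⊥.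
  rcases eq_or_ne Rl 0 with h0 | h0
  · have hv : lam ∈ values := hval.2 ⟨1, norm_one, by rw [h0]; exact Polynomial.eval_zero⟩
    have hker := hT.kernel_ne_bot_of_symbol_eq_zero h0
    have hRin : Rin = 0 := by simp only [Rin, inFactor, if_pos h0]
    have hRinbar : Rinbar = 0 := by
      change circleFactor Rl * Rin = 0
      rw [hRin, mul_zero]
    have hF : ¬ IsFredholm Tl := fun h => hv1 hv h.finite_coker
    have hI := hv2 hv
    rw [hRin, hRinbar, hSd]
    simp [hv, hker, hF, hI]
  obtain ⟨t, ht, ht', hReq⟩ := exists_eq_inFactor_mul h0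
  have hRin : Rin ≠ 0 := inFactor_ne_zero h0
  have hRin' : ∀ z, Rin.IsRoot z → ‖z‖ < 1 := fun z hz => norm_lt_one_of_isRoot_inFactor h0 hz
  have hCt : circleFactor Rl * t ≠ 0 := mul_ne_zero (circleFactor_ne_zero h0) ht
  have hCt' : ∀ z, (circleFactor Rl * t).IsRoot z → 1 ≤ ‖z‖ := fun z hz => by
    rw [Polynomial.IsRoot, Polynomial.eval_mul, mul_eq_zero] at hz
    rcases hz with hz | hz
    · exact (norm_eq_one_of_isRoot_circleFactor h0 hz).ge
    · exact (ht' z hz).le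
  have hRinbar : Rinbar ≠ 0 := mul_ne_zero (circleFactor_ne_zero h0) hRin
  have hRd : Rin.degree = (Rin.natDegree : WithBot ℕ) := Polynomial.degree_eq_natDegree hRin
  have hRbd : Rinbar.degree = (Rinbar.natDegree : WithBot ℕ) :=
    Polynomial.degree_eq_natDegree hRinbar
  have hle : Rin.natDegree ≤ Rinbar.natDegree := by
    change _ ≤ (circleFactor Rl * Rin).natDegree
    rw [Polynomial.natDegree_mul (circleFactor_ne_zero h0) hRin]
    omega
  -- Circle zeros are grouped with the inner ones here, so the kernel dimension is known whether or
  -- not λ is a value of the symbol.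
  obtain ⟨hk1, hk2⟩ := hT.finrank_kernel (s := Rinbar) (t := t)
    (hReq.trans (by change Rin * _ = circleFactor Rl * Rin * t; ring)) hRinbar ht
    (fun z hz => by
      change (circleFactor Rl * Rin).IsRoot z at hz
      rw [Polynomial.IsRoot, Polynomial.eval_mul, mul_eq_zero] at hz
      rcases hz with hz | hz
      · exact (norm_eq_one_of_isRoot_circleFactor h0 hz).le
      · exact (hRin' z hz).le) ht'
  have hker : kernel Tl = ⊥ ↔ Sin.natDegree ≤ Rinbar.natDegree := by
    rw [← Submodule.finrank_eq_zero, hk2, Nat.sub_eq_zero_iff_le]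
  have hdense : Dense (range Tl : Set hardySpace) ↔ Rin.natDegree ≤ Sin.natDegree := by
    constructor
    · intro h
      by_contra! hlt
      exact hT.not_dense_range hReq hRin hRin' hlt h
    · exact hT.dense_range hReq hRin hCt hRin' hCt'
  have hout : lam ∉ values → ∀ z, (circleFactor Rl * t).IsRoot z → 1 < ‖z‖ := fun hv z hz =>
    lt_of_le_of_ne (hCt' z hz) fun h1 => hv (hval.2 ⟨z, h1.symm, by
      rw [hReq, Polynomial.IsRoot, Polynomial.eval_mul, hz.eq_zero, mul_zero]⟩)
  have hfred : lam ∉ values → IsFredholm Tl := fun hv =>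
    hT.isFredholm hReq hRin hCt hRin' (hout hv)
  have hfin : lam ∉ values → Module.finrank ℂ (kernel Tl) = Sin.natDegree - Rin.natDegree :=
    fun hv => (hT.finrank_kernel hReq hRin hCt (fun z hz => (hRin' z hz).le) (hout hv)).2
  have hcof : lam ∉ values →
      Module.finrank ℂ (hardySpace ⧸ range Tl) = Rin.natDegree - Sin.natDegree :=
    fun hv => (hT.finrank_cokernel hReq hRin hCt hRin' (hout hv)).2.1
  have hF : IsFredholm Tl ↔ lam ∉ values := ⟨fun h hv => hv1 hv h.finite_coker, hfred⟩
  have hI : IsContinuouslyInvertible Tl ↔ lam ∉ values ∧ Sin.natDegree ≤ Rin.natDegree := by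
    constructor
    · intro h
      have hv : lam ∉ values := fun hv => hv2 hv h
      have := (hfred hv).finite_ker
      have h1 := hfin hv
      rw [h.1, finrank_bot] at h1
      exact ⟨hv, by omega⟩
    · rintro ⟨hv, h⟩
      exact hT.isContinuouslyInvertible hReq hRin hCt hRin' (hout hv) h
  have hres : IsContinuouslyInvertible Tl ∧ range Tl = ⊤ ↔
      lam ∉ values ∧ Sin.natDegree = Rin.natDegree := by
    rw [hI]
    constructor
    · rintro ⟨⟨hv, h1⟩, h2⟩
      refine ⟨hv, le_antisymm h1 (hdense.1 ?_)⟩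
      rw [h2]
      exact dense_univ
    · rintro ⟨hv, h1⟩
      -- Finiteness rules out that rank 0 is merely the default value for infinite dimension.
      have := (hfred hv).finite_coker
      have h2 := hcof hv
      rw [h1, Nat.sub_self, Module.finrank_zero_iff] at h2
      exact ⟨⟨hv, h1.le⟩, Submodule.Quotient.subsingleton_iff.1 h2⟩
  rw [hSd, hRd, hRbd]
  simp only [Nat.cast_inj, Nat.cast_le, Nat.cast_lt, ne_eq]
  refine ⟨hF, fun h => ?_, hI, hres, ?_, ?_, ?_, ?_⟩
  · have hv := hF.1 h
    have h1 := hfin hv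
    have h2 := hcof hv
    have := h.finite_coker
    have : CompleteSpace (range Tl) := h.closed_range.completeSpace_coe
    have E := (range Tl).quotientEquivOfIsCompl _ (range Tl).isCompl_orthogonal
    refine ⟨?_, E.finiteDimensional, ?_, ?_⟩
    · rw [h1]; omega
    · rw [← E.finrank_eq, h2]; omega
    · rw [index, h1, h2]; omega
  · rw [hres, not_and_or, not_not]
  · rw [hker, not_le]
  · rw [hker, hdense]
    constructor
    · rintro ⟨h1, h2, h3⟩
      refine ⟨?_, h2, h1⟩
      by_contra hv
      exact h3 (hfred hv).closed_range
    · rintro ⟨hv, h2, h1⟩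
      refine ⟨h1, h2, fun hcl => hv1 hv ?_⟩
      -- A closed dense range would be everything, contradicting the infinite-dimensional cokernel
      -- at a value of the symbol.
      have htop : range Tl = ⊤ := by
        have := (hdense.2 h2).closure_eq
        rw [hcl.closure_eq] at this
        exact SetLike.coe_injective this
      rw [htop]
      infer_instance
  · rw [hker, hdense]
    omega
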